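/- Let $d\ge 0$ and $L\ge 1$ be integers and let $\phi^{(1)},\dots,\phi^{(L)}$ be real polynomials. For $n\in\mathbb{N}$ consider the fully-connected network with $L$ hidden layers of width $n$, parameters $\theta=(U,W^{(2)},\dots,W^{(L)},V)$ with $U\in\mathbb{R}^{n\times d}$, $W^{(\ell)}\in\mathbb{R}^{n\times n}$, $V\in\mathbb{R}^n$, and network function $f_\theta:\mathbb{R}^d\to\mathbb{R}$ given by $$x^{(1)}=\phi^{(1)}(d^{-1/2}Ux),\qquad x^{(\ell)}=\phi^{(\ell)}(n^{-1/2}W^{(\ell)}x^{(\ell-1)})\ \ (2\le\ell\le L),\qquad f_\theta(x)=n^{-1/2}V^{T}x^{(L)},$$ where polynomials act entrywise. All entries of $\theta$ are i.i.d. $\mathcal{N}(0,1)$. A *product of derivative tensors* is a function $$\mathcal{F}(x_1,\dots,x_m)=\sum_{\mu_1,\dots,\mu_r}\ \prod_{K=1}^m \partial^{k_K}f_\theta(x_K),$$ where $\partial^{k}f_\theta(x)$ denotes the rank-$k$ tensor of partial derivatives $\partial^k f_\theta(x)/\partial\theta^{\nu_1}\cdots\partial\theta^{\nu_k}$ with respect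 to the parameters, each tensor index is one of the summation indices $\mu_1,\dots,\mu_r$, each summation index occurs in exactly two index positions, and each $\mu_s$ is summed over all parameters. Its *cluster graph* has the $m$ tensors as vertices, with an edge between two tensors whenever they share a summation index. Let $n_e$ and $n_o$ be the numbers of connected components of the cluster graph with an even, respectively odd, number of vertices, and put $s_C=n_e+\tfrac12(n_o-m)$. **Theorem.** Let $\mathcal{F}_x(x_1,\dots,x_{m_x})$ and $\mathcal{F}_y(y_1,\dots,y_{m_y})$ be two products of derivative tensors (of fixed index structures, at fixed inputs in $\mathbb{R}^d$), with component counts $(n_{e,x},n_{o,x})$, $(n_{e,y},n_{o,y})$ and exponents $s_{C,x}$, $s_{C,y}$. Then $\mathcal{F}_x$ and $\mathcal{F}_y$ are square-integrable for every $n$, and: 1. if $n_{o,x}+n_{o,y}$ is even, then $\mathrm{Cov}_\theta(\mathcal{F}_x,\mathcal{F}_y)=\mathcal{O}(n^{s_V})$ as $n\to\infty$, where $$s_V=\begin{cases}s_{C,x}+s_{C,y}-1,& n_{o,x}+n_{o,y}=0,\\ s_{C,x}+s_{C,y},& n_{o,x}+n_{o,y}\neq 0;\end{cases}$$ 2. if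 $n_{o,x}+n_{o,y}$ is odd, then $\mathrm{Cov}_\theta(\mathcal{F}_x,\mathcal{F}_y)=0$ for every $n$. -/

import Mathlib

open MeasureTheory ProbabilityTheory Filter Asymptotics Polynomial

noncomputable section

namespace WideNet

/-- Index set of the parameters of a fully-connected network with input dimension `d` and
`L = H + 1` hidden layers of width `n`: the entries of `U` (an `n × d` matrix), of
`W^(2), …, W^(L)` (there are `H` of these `n × n` matrices, numbered from `0`), and of the
vector `V`. -/
abbrev Param (H d n : ℕ) : Type :=
  (Fin n × Fin d) ⊕ (Fin H × Fin n × Fin n) ⊕ Fin n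

section Network

variable {H d n : ℕ}

/-- The entry `U_{iα}` of the input weight matrix. -/
def wU (θ : Param H d n → ℝ) (i : Fin n) (α : Fin d) : ℝ := θ (Sum.inl (i, α))

/-- The entry `(i, j)` of the weight matrix from hidden layer `ℓ + 1` to hidden layer `ℓ + 2`
(hidden layers counted from `1`). -/
def wW (θ : Param H d n → ℝ) (ℓ : Fin H) (i j : Fin n) : ℝ := θ (Sum.inr (Sum.inl (ℓ, i, j)))

/-- The entry `V_i` of the output weight vector. -/
def wV (θ : Param H d n → ℝ) (i : Fin n) : ℝ := θ (Sum.inr (Sum.inr i))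

/-- Post-activations of the hidden layers (counted from `0` here): the first one is
`φ (d^{-1/2} U x)`, and each later one is `φ (n^{-1/2} W x')` with `x'` the preceding one. -/
def postAct (φ : Fin (H + 1) → ℝ[X]) (θ : Param H d n → ℝ) (x : Fin d → ℝ) :
    Fin (H + 1) → Fin n → ℝ :=
  Fin.induction (motive := fun _ => Fin n → ℝ)
    (fun i => (φ 0).eval ((√(d : ℝ))⁻¹ * ∑ α, wU θ i α * x α))
    (fun ℓ prev i => (φ ℓ.succ).eval ((√(n : ℝ))⁻¹ * ∑ j, wW θ ℓ i j * prev j))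

/-- The network function `f_θ(x) = n^{-1/2} Vᵀ x^(L)`. -/
def network (φ : Fin (H + 1) → ℝ[X]) (x : Fin d → ℝ) (θ : Param H d n → ℝ) : ℝ :=
  (√(n : ℝ))⁻¹ * ∑ i, wV θ i * postAct φ θ x (Fin.last H) i

/-- The law of the parameters at initialization: i.i.d. standard Gaussians. -/
def initLaw (H d n : ℕ) : Measure (Param H d n → ℝ) :=
  Measure.pi fun _ => gaussianReal 0 1

end Network

/-- The component `∂^k g / ∂θ^{μ 0} ⋯ ∂θ^{μ (k-1)}` of the rank-`k` derivative tensor of `g`. -/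
def derivTensor {ι : Type} [DecidableEq ι] (g : (ι → ℝ) → ℝ) :
    (k : ℕ) → (Fin k → ι) → (ι → ℝ) → ℝ
  | 0, _ => g
  | k + 1, μ => fun θ => lineDeriv ℝ (derivTensor g k (Fin.tail μ)) θ (Pi.single (μ 0) 1)

/-- The index structure of a product of `m` derivative tensors in which all tensor indices are
summed in pairs. There are `r` summation indices; the `a`-th index of the `K`-th tensor, of rank
`k K`, is the summation index `idx K a`, and every summation index occurs exactly twice. -/
structure TensorProductShape where
  /-- Number of derivative tensors. -/
  m : ℕ
  /-- Ranks of the derivative tensors. -/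
  k : Fin m → ℕ
  /-- Number of summation indices. -/
  r : ℕ
  /-- The summation index in each tensor slot. -/
  idx : (K : Fin m) → Fin (k K) → Fin r
  paired : ∀ s : Fin r,
    (Finset.univ.filter fun p : (K : Fin m) × Fin (k K) => idx p.1 p.2 = s).card = 2

namespace TensorProductShape

/-- The cluster graph: vertices are the derivative tensors; two distinct tensors are adjacent iff
some of their indices are summed together. (A tensor contracted with itself would only give a
loop, which does not affect the components.) -/
def clusterGraph (S : TensorProductShape) : SimpleGraph (Fin S.m) where
  Adj I J := I ≠ J ∧ ∃ a b, S.idx I a = S.idx J b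
  symm := ⟨fun _ _ ⟨h, a, b, hab⟩ => ⟨h.symm, b, a, hab.symm⟩⟩
  loopless := ⟨fun _ h => h.1 rfl⟩

/-- The number of components of the cluster graph with an even number of vertices. -/
def nEven (S : TensorProductShape) : ℕ :=
  {c : S.clusterGraph.ConnectedComponent | Even c.supp.ncard}.ncard

/-- The number of components of the cluster graph with an odd number of vertices. -/
def nOdd (S : TensorProductShape) : ℕ :=
  {c : S.clusterGraph.ConnectedComponent | Odd c.supp.ncard}.ncard

/-- The exponent `s_C = n_e + (n_o - m) / 2`. -/
def sC (S : TensorProductShape) : ℝ := S.nEven + ((S.nOdd : ℝ) - S.m) / 2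

/-- The product of derivative tensors `∑_indices ∏_K ∂^{k_K} f_θ(x_K)`, as a function of `θ`. -/
def eval (S : TensorProductShape) {H d : ℕ} (φ : Fin (H + 1) → ℝ[X])
    (x : Fin S.m → Fin d → ℝ) (n : ℕ) (θ : Param H d n → ℝ) : ℝ :=
  ∑ μ : Fin S.r → Param H d n,
    ∏ K, derivTensor (network φ (x K)) (S.k K) (fun a => μ (S.idx K a)) θ

end TensorProductShape

/-- The exponent `s_V` of the covariance bound. -/
def sV (S T : TensorProductShape) : ℝ :=
  if S.nOdd + T.nOdd = 0 then S.sC + T.sC - 1 else S.sC + T.sC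

end WideNet

end

noncomputable section

namespace WideNet

/-! The network function is a polynomial in the parameters. View each parameter as an edge on the
hidden neurons, with entries of `U` and `V` as loops. Then every monomial of the network function is
connected, has degree one in `V`, has degree bounded independently of `n`, and has a coefficient of
size at most a constant times `n^{-1/2}` per factor from `W` or `V` (`exists_isRooted_networkPoly`).
Expanding both products gives a sum over configurations: values of the summation indices and one
monomial per tensor. Restoring the differentiated parameters gives for each tensor a full monomial
of the network function.

The covariance of two Gaussian monomials vanishes unless every parameter has even total exponent and
the two monomials share a parameter. Contracted indices occur in pairs, so the full monomials
inherit the evenness. Group the tensors into classes linked by shared parameters. A forest-type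
bound gives (neurons) ≤ (distinct `W`-edges) + (classes), and each `W`-edge is used at least twice.
With `m` tensors in all, 2·(neurons) ≤ (degree in `W`, `V`) − `m` + 2·(classes).

Classes are unions of clusters, and each has an even number of tensors because each tensor carries
exactly one `V`. A class therefore contains an even cluster or at least two odd ones, so (classes) ≤
`n_e + n_o/2`. If there are no odd clusters, the shared parameter merges a cluster of one product
with a cluster of the other, which gains the extra −1. This is `exponent_bound`; its parity
statement gives the exact vanishing.

Finally, a neuron set `A` of bounded size supports boundedly many configurations, and the sum of
`n^{-|A|}` over all `A` is bounded (`sum_inv_pow_card_le`). Hence the sum over configurations costs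
no power of `n` beyond `s_V`. -/

/-- The neurons of the hidden layers. -/
abbrev Neuron (H n : ℕ) : Type := Fin (H + 1) × Fin n

/-! ### Graphs of monomials: neurons, edges and classes of linked tensors. -/

section Combinatorics

variable {H d n : ℕ}

/-- The neuron that a parameter feeds into (for `V`, the neuron it reads from). -/
def outNeuron : Param H d n → Neuron H n
  | .inl (i, _) => (0, i)
  | .inr (.inl (ℓ, i, _)) => (ℓ.succ, i)
  | .inr (.inr i) => (Fin.last H, i)

/-- The neuron that a parameter reads from (for `U`, the neuron it feeds into). -/
def inNeuron : Param H d n → Neuron H n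
  | .inl (i, _) => (0, i)
  | .inr (.inl (ℓ, _, j)) => (ℓ.castSucc, j)
  | .inr (.inr i) => (Fin.last H, i)

/-- The total degree of a monomial in the entries of the matrices `W` and of `V`. -/
def degWV : (Param H d n →₀ ℕ) →+ ℕ where
  toFun s := ∑ e, s (Sum.inr e)
  map_zero' := by simp
  map_add' s t := by simp [Finset.sum_add_distrib]

/-- The total degree of a monomial in the entries of `V`. -/
def degV : (Param H d n →₀ ℕ) →+ ℕ where
  toFun s := ∑ i, s (Sum.inr (Sum.inr i))
  map_zero' := by simp
  map_add' s t := by simp [Finset.sum_add_distrib]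

theorem degWV_apply (s : Param H d n →₀ ℕ) : degWV s = ∑ e, s (Sum.inr e) := rfl

theorem degV_apply (s : Param H d n →₀ ℕ) : degV s = ∑ i, s (Sum.inr (Sum.inr i)) := rfl

/-- The neurons of the parameters in the monomial `s` all lie in the component of `v`, in the graph
whose edges are the parameters in `s`; expressed through functions constant along edges. -/
def ConnectedTo (v : Neuron H n) (s : Param H d n →₀ ℕ) : Prop :=
  ∀ g : Neuron H n → ℚ, (∀ p, s p ≠ 0 → g (outNeuron p) = g (inNeuron p)) →
    ∀ p, s p ≠ 0 → g (outNeuron p) = g v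

theorem ConnectedTo.zero (v : Neuron H n) : ConnectedTo v (0 : Param H d n →₀ ℕ) :=
  fun _ _ _ hp => absurd rfl hp

theorem ConnectedTo.add {v : Neuron H n} {s t : Param H d n →₀ ℕ} (hs : ConnectedTo v s)
    (ht : ConnectedTo v t) : ConnectedTo v (s + t) := by
  intro g hg p hp
  have h : s p ≠ 0 ∨ t p ≠ 0 := by
    by_contra! h
    exact hp (by simp [h.1, h.2])
  rcases h with h | h
  · exact hs g (fun q hq => hg q (by simp [hq])) p h
  · exact ht g (fun q hq => hg q (by simp [hq])) p h

theorem ConnectedTo.single_add (e : Param H d n) {s : Param H d n →₀ ℕ}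
    (hs : ConnectedTo (inNeuron e) s) :
    ConnectedTo (outNeuron e) (Finsupp.single e 1 + s) := by
  intro g hg p hp
  have he := hg e (by simp)
  rcases eq_or_ne (s p) 0 with h | h
  · have hpe : p = e := by
      by_contra hne
      exact hp (by simp [h, Ne.symm hne])
    rw [hpe]
  · rw [he]
    exact hs g (fun q hq => hg q (by simp [hq])) p h

/-- The neurons met by the parameters of a monomial. -/
def neurons (s : Param H d n →₀ ℕ) : Finset (Neuron H n) :=
  s.support.image outNeuron ∪ s.support.image inNeuron

theorem outNeuron_mem_neurons {s : Param H d n →₀ ℕ} {p : Param H d n} (hp : s p ≠ 0) :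
    outNeuron p ∈ neurons s :=
  Finset.mem_union_left _ (Finset.mem_image_of_mem _ (Finsupp.mem_support_iff.2 hp))

theorem inNeuron_mem_neurons {s : Param H d n →₀ ℕ} {p : Param H d n} (hp : s p ≠ 0) :
    inNeuron p ∈ neurons s :=
  Finset.mem_union_right _ (Finset.mem_image_of_mem _ (Finsupp.mem_support_iff.2 hp))

theorem card_support_le_degree {σ : Type*} (s : σ →₀ ℕ) : s.support.card ≤ s.degree := by
  rw [Finsupp.degree_apply, Finset.card_eq_sum_ones]
  exact Finset.sum_le_sum fun i hi => Nat.one_le_iff_ne_zero.2 (Finsupp.mem_support_iff.1 hi)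

theorem card_neurons_le (s : Param H d n →₀ ℕ) : (neurons s).card ≤ 2 * s.degree := by
  have h := card_support_le_degree s
  have h1 := Finset.card_union_le (s.support.image outNeuron) (s.support.image inNeuron)
  have h2 := Finset.card_image_le (s := s.support) (f := outNeuron)
  have h3 := Finset.card_image_le (s := s.support) (f := inNeuron)
  unfold neurons
  omega

/-- Two monomials of a family share a parameter. -/
def SharesParam {I : Type*} (t : I → Param H d n →₀ ℕ) (J K : I) : Prop :=
  ∃ p, t J p ≠ 0 ∧ t K p ≠ 0

/-- Since each monomial has degree one in `V`, the size of a class is its total degree in `V`. All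
monomials containing a given `V_i` lie in one class, so `V_i` contributes either nothing or its
full, even exponent. -/
theorem even_card_quot_fiber {I : Type*} [Fintype I] {t : I → Param H d n →₀ ℕ}
    (hV : ∀ K, degV (t K) = 1) (heven : ∀ p, Even (∑ K, t K p)) [DecidableEq (Quot (SharesParam t))]
    (c : Quot (SharesParam t)) :
    Even (Finset.univ.filter fun K => Quot.mk (SharesParam t) K = c).card := by
  rw [Finset.card_eq_sum_ones, Finset.sum_congr rfl fun K _ => (hV K).symm]
  simp only [degV_apply]
  rw [Finset.sum_comm]
  refine Finset.even_sum _ fun i _ => ?_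
  by_cases h : ∃ J, Quot.mk (SharesParam t) J = c ∧ t J (Sum.inr (Sum.inr i)) ≠ 0
  · obtain ⟨J, hJ, hJi⟩ := h
    rw [Finset.sum_subset (Finset.subset_univ _) fun K _ hK => ?_]
    · exact heven (Sum.inr (Sum.inr i))
    by_contra hKi
    refine hK (Finset.mem_filter.2 ⟨Finset.mem_univ _, ?_⟩)
    rw [← hJ]
    exact Quot.sound ⟨_, hKi, hJi⟩
  · push Not at h
    rw [Finset.sum_eq_zero fun K hK => h K (Finset.mem_filter.1 hK).2]
    exact Even.zero

/-- The bound (vertices) ≤ (edges) + (components), by linear algebra: a rational function on the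
neurons is determined by its differences along the `W`-edges and its value at one root per class.
`U` and `V` are loops and impose no condition. -/
theorem card_neurons_le_of_connectedTo {I : Type*} [Fintype I] {t : I → Param H d n →₀ ℕ}
    (hc : ∀ K, ∃ v, ConnectedTo v (t K)) [Fintype (Quot (SharesParam t))] :
    (neurons (∑ K, t K)).card ≤
      (Finset.univ.filter fun e => (∑ K, t K) (Sum.inr (Sum.inl e)) ≠ 0).card +
        Fintype.card (Quot (SharesParam t)) := by
  classical
  choose v hv using hc
  set s := ∑ K, t K with hs
  have hmem : ∀ K p, t K p ≠ 0 → s p ≠ 0 := by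
    intro K p hp h0
    rw [hs, Finsupp.finsetSum_apply, Finset.sum_eq_zero_iff] at h0
    exact hp (h0 K (Finset.mem_univ _))
  have hmem' : ∀ p, s p ≠ 0 → ∃ K, t K p ≠ 0 := by
    intro p hp
    by_contra! h
    exact hp (by simp [hs, h])
  let E := Finset.univ.filter fun e => s (Sum.inr (Sum.inl e)) ≠ 0
  let ext : (neurons s → ℚ) →ₗ[ℚ] (Neuron H n → ℚ) :=
    { toFun := fun g u => if h : u ∈ neurons s then g ⟨u, h⟩ else 0
      map_add' := fun g g' => by ext u; by_cases h : u ∈ neurons s <;> simp [h]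
      map_smul' := fun a g => by ext u; by_cases h : u ∈ neurons s <;> simp [h] }
  let A : (Neuron H n → ℚ) →ₗ[ℚ] (E → ℚ) × (Quot (SharesParam t) → ℚ) :=
    { toFun := fun g =>
        (fun e => g (outNeuron (d := d) (Sum.inr (Sum.inl e.1))) -
          g (inNeuron (d := d) (Sum.inr (Sum.inl e.1))), fun c => g (v c.out))
      map_add' := fun g g' => by ext <;> simp; ring
      map_smul' := fun a g => by ext <;> simp; ring }
  have hinj : Function.Injective (A ∘ₗ ext) := by
    rw [← LinearMap.ker_eq_bot, LinearMap.ker_eq_bot']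
    intro g hg
    have h1 : ∀ p, s p ≠ 0 → ext g (outNeuron p) = ext g (inNeuron p) := by
      rintro (⟨i, α⟩ | e | i) hp
      · rfl
      · have := congrFun (congrArg Prod.fst hg) ⟨e, by simpa [E] using hp⟩
        exact sub_eq_zero.1 this
      · rfl
    have h2 : ∀ K p, t K p ≠ 0 → ext g (outNeuron p) = ext g (v K) := fun K p hp =>
      hv K (ext g) (fun q hq => h1 q (hmem K q hq)) p hp
    have h3 : ∀ K, ext g (v K) = 0 := by
      have hl : ∀ J K, SharesParam t J K → ext g (v J) = ext g (v K) := fun J K ⟨p, hJ, hK⟩ =>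
        (h2 J p hJ).symm.trans (h2 K p hK)
      intro K
      have h4 : Quot.lift _ hl (Quot.mk _ K) = 0 := by
        rw [← Quot.out_eq (Quot.mk _ K)]
        exact congrFun (congrArg Prod.snd hg) (Quot.mk _ K)
      exact h4
    have h5 : ∀ p, s p ≠ 0 → ext g (outNeuron p) = 0 := fun p hp => by
      obtain ⟨K, hK⟩ := hmem' p hp
      rw [h2 K p hK, h3]
    ext ⟨u, hu⟩
    have h6 : ext g u = g ⟨u, hu⟩ := by simp [ext, hu]
    rw [← h6]
    rcases Finset.mem_union.1 hu with h | h
    · obtain ⟨p, hp, rfl⟩ := Finset.mem_image.1 h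
      exact h5 p (Finsupp.mem_support_iff.1 hp)
    · obtain ⟨p, hp, rfl⟩ := Finset.mem_image.1 h
      rw [← h1 p (Finsupp.mem_support_iff.1 hp)]
      exact h5 p (Finsupp.mem_support_iff.1 hp)
  have := LinearMap.finrank_le_finrank_of_injective hinj
  rwa [Module.finrank_prod, Module.finrank_fintype_fun_eq_card, Module.finrank_fintype_fun_eq_card,
    Module.finrank_fintype_fun_eq_card, Fintype.card_coe, Fintype.card_coe] at this

theorem two_mul_card_neurons_add_card_le {I : Type*} [Fintype I] {t : I → Param H d n →₀ ℕ}
    (hV : ∀ K, degV (t K) = 1) (hc : ∀ K, ∃ v, ConnectedTo v (t K))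
    (heven : ∀ p, Even (∑ K, t K p)) [Fintype (Quot (SharesParam t))] :
    2 * (neurons (∑ K, t K)).card + Fintype.card I ≤
      degWV (∑ K, t K) + 2 * Fintype.card (Quot (SharesParam t)) := by
  have h := card_neurons_le_of_connectedTo hc
  set s := ∑ K, t K with hs
  have hVs : degV s = Fintype.card I := by
    rw [hs, map_sum, Finset.sum_congr rfl fun K _ => hV K]; simp
  -- A `W`-entry that occurs has a positive even exponent, hence at least 2.
  have hE : 2 * (Finset.univ.filter fun e => s (Sum.inr (Sum.inl e)) ≠ 0).card ≤
      ∑ e, s (Sum.inr (Sum.inl e)) := by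
    rw [← Finset.sum_filter_ne_zero, mul_comm, ← smul_eq_mul]
    refine Finset.card_nsmul_le_sum _ _ _ fun e he => ?_
    have h0 := (Finset.mem_filter.1 he).2
    have h2 := heven (Sum.inr (Sum.inl e))
    rw [← Finsupp.finsetSum_apply, ← hs] at h2
    obtain ⟨k, hk⟩ := h2
    omega
  have hsum : degWV s = ∑ e, s (Sum.inr (Sum.inl e)) + degV s := by
    rw [degWV_apply, degV_apply, Fintype.sum_sum_type]
  omega

end Combinatorics

/-! ### Parity count of clusters inside classes. -/

section Fibers

/-- The weights have the parity of the fibres of `f`, so the total weight over each point of `C` is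
even; being positive, it is at least 2. -/
theorem two_mul_card_le_sum_of_even_fibers {I Q C : Type*} [Fintype I] [Fintype Q] [Fintype C]
    [DecidableEq Q] [DecidableEq C] (f : I → Q) (g : Q → C) (hg : Function.Surjective g)
    (heven : ∀ c, Even (Finset.univ.filter fun K => g (f K) = c).card) (w : Q → ℕ)
    (hw : ∀ q, 1 ≤ w q) (hpar : ∀ q, Even (w q + (Finset.univ.filter fun K => f K = q).card)) :
    2 * Fintype.card C ≤ ∑ q, w q := by
  rw [← Finset.sum_fiberwise Finset.univ g w, mul_comm, ← smul_eq_mul]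
  refine Finset.card_nsmul_le_sum _ _ _ fun c _ => ?_
  obtain ⟨q, hq⟩ := hg c
  have h1 : 1 ≤ ∑ q ∈ Finset.univ.filter (fun q => g q = c), w q :=
    (hw q).trans (Finset.single_le_sum (f := w) (fun _ _ => Nat.zero_le _) (by simp [hq]))
  have h2 : (Finset.univ.filter fun K => g (f K) = c).card =
      ∑ q ∈ Finset.univ.filter (fun q => g q = c),
        (Finset.univ.filter fun K => f K = q).card := by
    rw [Finset.card_eq_sum_card_fiberwise (f := f)
      (t := Finset.univ.filter (fun q => g q = c)) (by intro K hK; simpa using hK)]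
    refine Finset.sum_congr rfl fun q hq => ?_
    congr 1
    ext K
    have := (Finset.mem_filter.1 hq).2
    simp only [Finset.mem_filter, Finset.mem_univ, true_and, and_iff_right_iff_imp]
    rintro rfl
    exact this
  have h3 : Even (∑ q ∈ Finset.univ.filter (fun q => g q = c),
      (w q + (Finset.univ.filter fun K => f K = q).card)) :=
    Finset.even_sum _ fun q _ => hpar q
  rw [Finset.sum_add_distrib, ← h2, Nat.even_add] at h3
  obtain ⟨k, hk⟩ := h3.2 (heven c)
  omega

end Fibers

/-! ### Polynomials with connected monomials and coefficient bounds uniform in the width. -/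

section Rooted

/-- The number of factorizations of a monomial is controlled by its degree alone. This keeps the
constants for products independent of `n`, although the number of variables grows with `n`. -/
theorem card_antidiagonal_le_two_pow {σ : Type*} [DecidableEq σ] (s : σ →₀ ℕ) :
    (Finset.HasAntidiagonal.antidiagonal s).card ≤ 2 ^ s.degree := by
  calc (Finset.HasAntidiagonal.antidiagonal s).card ≤ (Finset.Iic s).card := by
        refine Finset.card_le_card_of_injOn Prod.fst (fun a ha => ?_) fun a ha b hb hab => ?_
        · simpa using (le_self_add).trans_eq (Finset.HasAntidiagonal.mem_antidiagonal.1 ha)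
        · have h := (Finset.HasAntidiagonal.mem_antidiagonal.1 ha).trans
            (Finset.HasAntidiagonal.mem_antidiagonal.1 hb).symm
          rw [hab] at h
          exact Prod.ext hab (add_left_cancel h)
    _ ≤ ∏ i ∈ s.support, 2 ^ s i := by
        rw [Finsupp.card_Iic]
        refine Finset.prod_le_prod' fun i _ => ?_
        rw [Nat.card_Iic]
        exact Nat.lt_two_pow_self
    _ = 2 ^ s.degree := by rw [Finset.prod_pow_eq_pow_sum, Finsupp.degree_apply]

variable {H d n : ℕ}

/-- The monomials of `P` have bounded degree and prescribed degree in `V`, they are connected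
to `v`, and each factor from some `W` or from `V` costs a factor `n^{-1/2}`. -/
structure IsRooted (C : ℝ) (D ν : ℕ) (v : Neuron H n) (P : MvPolynomial (Param H d n) ℝ) :
    Prop where
  degree_le : ∀ s, MvPolynomial.coeff s P ≠ 0 → s.degree ≤ D
  degV_eq : ∀ s, MvPolynomial.coeff s P ≠ 0 → degV s = ν
  connectedTo : ∀ s, MvPolynomial.coeff s P ≠ 0 → ConnectedTo v s
  abs_coeff_le : ∀ s, |MvPolynomial.coeff s P| ≤ C * (√(n : ℝ))⁻¹ ^ degWV s

namespace IsRooted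

variable {C C' : ℝ} {D D' ν ν' : ℕ} {v : Neuron H n} {P P' : MvPolynomial (Param H d n) ℝ}

theorem nonneg (h : IsRooted C D ν v P) : 0 ≤ C := by
  simpa using (abs_nonneg _).trans (h.abs_coeff_le 0)

theorem const (v : Neuron H n) (a : ℝ) :
    IsRooted |a| 0 0 v (MvPolynomial.C a : MvPolynomial (Param H d n) ℝ) := by
  have h0 : ∀ s, MvPolynomial.coeff s (MvPolynomial.C a : MvPolynomial (Param H d n) ℝ) ≠ 0 →
      s = 0 := by
    intro s hs
    rw [MvPolynomial.coeff_C] at hs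
    by_contra h
    exact hs (if_neg (Ne.symm h))
  refine ⟨fun s hs => ?_, fun s hs => ?_, fun s hs => ?_, fun s => ?_⟩
  · simp [h0 s hs]
  · simp [h0 s hs]
  · rw [h0 s hs]; exact ConnectedTo.zero v
  · by_cases hs : MvPolynomial.coeff s (MvPolynomial.C a : MvPolynomial (Param H d n) ℝ) = 0
    · rw [hs, abs_zero]; positivity
    · simp [h0 s hs]

theorem add (h : IsRooted C D ν v P) (h' : IsRooted C' D' ν v P') :
    IsRooted (C + C') (max D D') ν v (P + P') := by
  have hor : ∀ s, MvPolynomial.coeff s (P + P') ≠ 0 →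
      MvPolynomial.coeff s P ≠ 0 ∨ MvPolynomial.coeff s P' ≠ 0 := by
    intro s hs
    by_contra! h0
    exact hs (by rw [MvPolynomial.coeff_add, h0.1, h0.2, add_zero])
  refine ⟨fun s hs => ?_, fun s hs => ?_, fun s hs => ?_, fun s => ?_⟩
  · exact (hor s hs).elim (fun h0 => (h.degree_le s h0).trans (le_max_left _ _))
      fun h0 => (h'.degree_le s h0).trans (le_max_right _ _)
  · exact (hor s hs).elim (h.degV_eq s) (h'.degV_eq s)
  · exact (hor s hs).elim (h.connectedTo s) (h'.connectedTo s)
  · rw [MvPolynomial.coeff_add, add_mul]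
    exact (abs_add_le _ _).trans (add_le_add (h.abs_coeff_le s) (h'.abs_coeff_le s))

theorem mul (h : IsRooted C D ν v P) (h' : IsRooted C' D' ν' v P') :
    IsRooted (2 ^ (D + D') * (C * C')) (D + D') (ν + ν') v (P * P') := by
  have hex : ∀ s, MvPolynomial.coeff s (P * P') ≠ 0 →
      ∃ a b, a + b = s ∧ MvPolynomial.coeff a P ≠ 0 ∧ MvPolynomial.coeff b P' ≠ 0 := by
    intro s hs
    rw [MvPolynomial.coeff_mul] at hs
    obtain ⟨a, ha, hne⟩ := Finset.exists_ne_zero_of_sum_ne_zero hs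
    exact ⟨a.1, a.2, Finset.HasAntidiagonal.mem_antidiagonal.1 ha, left_ne_zero_of_mul hne,
      right_ne_zero_of_mul hne⟩
  have hdeg : ∀ s, MvPolynomial.coeff s (P * P') ≠ 0 → s.degree ≤ D + D' := by
    intro s hs
    obtain ⟨a, b, rfl, ha, hb⟩ := hex s hs
    rw [map_add]
    exact add_le_add (h.degree_le a ha) (h'.degree_le b hb)
  refine ⟨hdeg, fun s hs => ?_, fun s hs => ?_, fun s => ?_⟩
  · obtain ⟨a, b, rfl, ha, hb⟩ := hex s hs
    rw [map_add, h.degV_eq a ha, h'.degV_eq b hb]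
  · obtain ⟨a, b, rfl, ha, hb⟩ := hex s hs
    exact (h.connectedTo a ha).add (h'.connectedTo b hb)
  · have hC := h.nonneg
    have hC' := h'.nonneg
    by_cases hs : MvPolynomial.coeff s (P * P') = 0
    · rw [hs, abs_zero]; positivity
    · rw [MvPolynomial.coeff_mul]
      calc |∑ a ∈ Finset.HasAntidiagonal.antidiagonal s,
            MvPolynomial.coeff a.1 P * MvPolynomial.coeff a.2 P'|
          ≤ ∑ a ∈ Finset.HasAntidiagonal.antidiagonal s,
            |MvPolynomial.coeff a.1 P * MvPolynomial.coeff a.2 P'| :=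
            Finset.abs_sum_le_sum_abs _ _
        _ ≤ ∑ a ∈ Finset.HasAntidiagonal.antidiagonal s, C * C' * (√(n : ℝ))⁻¹ ^ degWV s := by
            refine Finset.sum_le_sum fun a ha => ?_
            rw [← Finset.HasAntidiagonal.mem_antidiagonal.1 ha, map_add, pow_add, abs_mul]
            calc _ ≤ (C * (√(n : ℝ))⁻¹ ^ degWV a.1) * (C' * (√(n : ℝ))⁻¹ ^ degWV a.2) :=
                  mul_le_mul (h.abs_coeff_le _) (h'.abs_coeff_le _) (abs_nonneg _) (by positivity)
              _ = _ := by ring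
        _ = (Finset.HasAntidiagonal.antidiagonal s).card * (C * C' * (√(n : ℝ))⁻¹ ^ degWV s) := by
            rw [Finset.sum_const, nsmul_eq_mul]
        _ ≤ 2 ^ (D + D') * (C * C' * (√(n : ℝ))⁻¹ ^ degWV s) := by
            gcongr
            have := (card_antidiagonal_le_two_pow s).trans
              (Nat.pow_le_pow_right two_pos (hdeg s hs))
            exact_mod_cast this
        _ = _ := by ring

/-- A weighted sum of rooted polynomials, with one parameter attached to each root. -/
theorem coeff_sum_X_mul {J : Type*} [Fintype J] {e : J → Param H d n} (he : Function.Injective e)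
    {a A : ℝ} {ω δ : ℕ} (ha : |a| ≤ A * (√(n : ℝ))⁻¹ ^ ω)
    (hω : ∀ j, degWV (Finsupp.single (e j) 1) = ω)
    (hδ : ∀ j, degV (Finsupp.single (e j) 1) = δ)
    {Q : J → MvPolynomial (Param H d n) ℝ} (hA : 0 ≤ A) (hC : 0 ≤ C)
    (hQ : ∀ j, IsRooted C D ν (inNeuron (e j)) (Q j)) :
    (∀ s, MvPolynomial.coeff s (MvPolynomial.C a * ∑ j, MvPolynomial.X (e j) * Q j) ≠ 0 →
      s.degree ≤ D + 1 ∧ degV s = δ + ν ∧ ∃ j, ConnectedTo (outNeuron (e j)) s) ∧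
    ∀ s, |MvPolynomial.coeff s (MvPolynomial.C a * ∑ j, MvPolynomial.X (e j) * Q j)| ≤
      A * ((D + 1) * C) * (√(n : ℝ))⁻¹ ^ degWV s := by
  set P := ∑ j, MvPolynomial.X (e j) * Q j with hP
  have hcoeff : ∀ s, MvPolynomial.coeff s P =
      ∑ j, if e j ∈ s.support then MvPolynomial.coeff (s - Finsupp.single (e j) 1) (Q j) else 0 := by
    intro s
    rw [hP, MvPolynomial.coeff_sum]
    exact Finset.sum_congr rfl fun j _ => MvPolynomial.coeff_X_mul' _ _ _
  have hsub : ∀ s j, e j ∈ s.support →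
      Finsupp.single (e j) 1 + (s - Finsupp.single (e j) 1) = s := by
    intro s j hj
    refine add_tsub_cancel_of_le ?_
    rw [Finsupp.single_le_iff]
    exact Nat.one_le_iff_ne_zero.2 (Finsupp.mem_support_iff.1 hj)
  have hex : ∀ s, MvPolynomial.coeff s (MvPolynomial.C a * P) ≠ 0 →
      ∃ j s', Finsupp.single (e j) 1 + s' = s ∧ MvPolynomial.coeff s' (Q j) ≠ 0 := by
    intro s hs
    rw [MvPolynomial.coeff_C_mul, hcoeff] at hs
    obtain ⟨j, -, hj⟩ := Finset.exists_ne_zero_of_sum_ne_zero (right_ne_zero_of_mul hs)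
    by_cases hm : e j ∈ s.support
    · rw [if_pos hm] at hj
      exact ⟨j, _, hsub s j hm, hj⟩
    · exact absurd (if_neg hm) hj
  have hdeg : ∀ s, MvPolynomial.coeff s (MvPolynomial.C a * P) ≠ 0 → s.degree ≤ D + 1 := by
    intro s hs
    obtain ⟨j, s', rfl, hj⟩ := hex s hs
    rw [map_add, Finsupp.degree_single, add_comm]
    exact Nat.add_le_add_right ((hQ j).degree_le s' hj) 1
  refine ⟨fun s hs => ⟨hdeg s hs, ?_, ?_⟩, fun s => ?_⟩
  · obtain ⟨j, s', rfl, hj⟩ := hex s hs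
    rw [map_add, hδ, (hQ j).degV_eq s' hj]
  · obtain ⟨j, s', rfl, hj⟩ := hex s hs
    exact ⟨j, .single_add (e j) ((hQ j).connectedTo s' hj)⟩
  · by_cases hs : MvPolynomial.coeff s (MvPolynomial.C a * P) = 0
    · rw [hs, abs_zero]; positivity
    -- Only those `j` whose variable divides `s` contribute to its coefficient. The sum may have `n`
    -- terms, but at most `D + 1` of them matter.
    · have hcard : (Finset.univ.filter fun j => e j ∈ s.support).card ≤ D + 1 := by
        calc _ ≤ s.support.card :=
              Finset.card_le_card_of_injOn e (fun j hj => (Finset.mem_filter.1 hj).2) he.injOn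
          _ ≤ D + 1 := (card_support_le_degree s).trans (hdeg s hs)
      rw [MvPolynomial.coeff_C_mul, hcoeff, ← Finset.sum_filter, abs_mul]
      calc |a| * |∑ j with e j ∈ s.support, MvPolynomial.coeff (s - Finsupp.single (e j) 1) (Q j)|
          ≤ (A * (√(n : ℝ))⁻¹ ^ ω) *
            ∑ j with e j ∈ s.support, |MvPolynomial.coeff (s - Finsupp.single (e j) 1) (Q j)| :=
            mul_le_mul ha (Finset.abs_sum_le_sum_abs _ _) (abs_nonneg _) (by positivity)
        _ = A * ∑ j with e j ∈ s.support,
            (√(n : ℝ))⁻¹ ^ ω * |MvPolynomial.coeff (s - Finsupp.single (e j) 1) (Q j)| := by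
            rw [mul_assoc, Finset.mul_sum]
        _ ≤ A * ∑ j with e j ∈ s.support, C * (√(n : ℝ))⁻¹ ^ degWV s := by
            refine mul_le_mul_of_nonneg_left (Finset.sum_le_sum fun j hj => ?_) hA
            conv_rhs => rw [← hsub s j (Finset.mem_filter.1 hj).2, map_add, hω, pow_add,
              mul_left_comm]
            exact mul_le_mul_of_nonneg_left ((hQ j).abs_coeff_le _) (by positivity)
        _ = A * ((Finset.univ.filter fun j => e j ∈ s.support).card *
              (C * (√(n : ℝ))⁻¹ ^ degWV s)) := by
            rw [Finset.sum_const, nsmul_eq_mul]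
        _ ≤ A * ((D + 1) * (C * (√(n : ℝ))⁻¹ ^ degWV s)) := by
            gcongr
            exact_mod_cast hcard
        _ = _ := by ring

theorem sum_X_mul {J : Type*} [Fintype J] {e : J → Param H d n} (he : Function.Injective e)
    {a A : ℝ} {ω δ : ℕ} (ha : |a| ≤ A * (√(n : ℝ))⁻¹ ^ ω)
    (hω : ∀ j, degWV (Finsupp.single (e j) 1) = ω)
    (hδ : ∀ j, degV (Finsupp.single (e j) 1) = δ) (hout : ∀ j, outNeuron (e j) = v)
    {Q : J → MvPolynomial (Param H d n) ℝ} (hA : 0 ≤ A) (hC : 0 ≤ C)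
    (hQ : ∀ j, IsRooted C D ν (inNeuron (e j)) (Q j)) :
    IsRooted (A * ((D + 1) * C)) (D + 1) (δ + ν) v
      (MvPolynomial.C a * ∑ j, MvPolynomial.X (e j) * Q j) := by
  obtain ⟨h, hb⟩ := coeff_sum_X_mul he ha hω hδ hA hC hQ
  refine ⟨fun s hs => (h s hs).1, fun s hs => (h s hs).2.1, fun s hs => ?_, hb⟩
  obtain ⟨j, hj⟩ := (h s hs).2.2
  rwa [hout j] at hj

end IsRooted

theorem exists_isRooted_pow (k : ℕ) (C : ℝ) (D : ℕ) : ∃ C' D', ∀ (n : ℕ) (v : Neuron H n)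
    (P : MvPolynomial (Param H d n) ℝ), IsRooted C D 0 v P → IsRooted C' D' 0 v (P ^ k) := by
  induction k with
  | zero => exact ⟨_, _, fun n v P _ => by simpa using IsRooted.const v 1⟩
  | succ k ih =>
    obtain ⟨C', D', h⟩ := ih
    exact ⟨_, _, fun n v P hP => by rw [pow_succ]; exact (h n v P hP).mul hP⟩

theorem exists_isRooted_aeval (q : ℝ[X]) (C : ℝ) (D : ℕ) : ∃ C' D', ∀ (n : ℕ) (v : Neuron H n)
    (P : MvPolynomial (Param H d n) ℝ),
    IsRooted C D 0 v P → IsRooted C' D' 0 v (Polynomial.aeval P q) := by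
  induction q using Polynomial.induction_on' with
  | add p q hp hq =>
    obtain ⟨C₁, D₁, h₁⟩ := hp
    obtain ⟨C₂, D₂, h₂⟩ := hq
    exact ⟨_, _, fun n v P hP => by rw [map_add]; exact (h₁ n v P hP).add (h₂ n v P hP)⟩
  | monomial k a =>
    obtain ⟨C', D', h⟩ := exists_isRooted_pow (H := H) (d := d) k C D
    exact ⟨_, _, fun n v P hP => by
      rw [Polynomial.aeval_monomial]
      exact (IsRooted.const v a).mul (h n v P hP)⟩

end Rooted

/-! ### The network function as a polynomial. -/

section NetworkPolynomial

variable {H d n : ℕ}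

/-- The post-activations as polynomials in the parameters. -/
def postActPoly (φ : Fin (H + 1) → ℝ[X]) (x : Fin d → ℝ) :
    Fin (H + 1) → Fin n → MvPolynomial (Param H d n) ℝ :=
  Fin.induction (motive := fun _ => Fin n → MvPolynomial (Param H d n) ℝ)
    (fun i => Polynomial.aeval (MvPolynomial.C (√(d : ℝ))⁻¹ *
      ∑ α, MvPolynomial.X (Sum.inl (i, α)) * MvPolynomial.C (x α)) (φ 0))
    (fun ℓ prev i => Polynomial.aeval (MvPolynomial.C (√(n : ℝ))⁻¹ *
      ∑ j, MvPolynomial.X (Sum.inr (Sum.inl (ℓ, i, j))) * prev j) (φ ℓ.succ))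

/-- The network function as a polynomial in the parameters. -/
def networkPoly (n : ℕ) (φ : Fin (H + 1) → ℝ[X]) (x : Fin d → ℝ) :
    MvPolynomial (Param H d n) ℝ :=
  MvPolynomial.C (√(n : ℝ))⁻¹ *
    ∑ i, MvPolynomial.X (Sum.inr (Sum.inr i)) * postActPoly φ x (Fin.last H) i

theorem eval_polynomial_aeval {σ : Type*} (θ : σ → ℝ) (P : MvPolynomial σ ℝ) (q : ℝ[X]) :
    MvPolynomial.eval θ (Polynomial.aeval P q) = q.eval (MvPolynomial.eval θ P) := by
  have := Polynomial.aeval_algHom_apply (MvPolynomial.aeval θ : MvPolynomial σ ℝ →ₐ[ℝ] ℝ) P q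
  rw [← MvPolynomial.coe_aeval_eq_eval, RingHom.coe_coe, ← this, Polynomial.coe_aeval_eq_eval]

theorem eval_postActPoly (φ : Fin (H + 1) → ℝ[X]) (x : Fin d → ℝ) (θ : Param H d n → ℝ)
    (ℓ : Fin (H + 1)) (i : Fin n) :
    MvPolynomial.eval θ (postActPoly φ x ℓ i) = postAct φ θ x ℓ i := by
  induction ℓ using Fin.induction generalizing i with
  | zero => simp [postActPoly, postAct, eval_polynomial_aeval, wU]
  | succ ℓ ih =>
    simp only [postActPoly, postAct, Fin.induction_succ] at ih ⊢
    simp [eval_polynomial_aeval, ih, wW]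

theorem eval_networkPoly (φ : Fin (H + 1) → ℝ[X]) (x : Fin d → ℝ) :
    (fun θ => MvPolynomial.eval θ (networkPoly n φ x)) = network φ x := by
  ext θ
  simp [networkPoly, network, eval_postActPoly, wV]

theorem exists_isRooted_postActPoly (φ : Fin (H + 1) → ℝ[X]) (x : Fin d → ℝ) (ℓ : Fin (H + 1)) :
    ∃ C D, 0 ≤ C ∧ ∀ (n : ℕ) (i : Fin n), IsRooted C D 0 (ℓ, i) (postActPoly φ x ℓ i) := by
  induction ℓ using Fin.induction with
  | zero =>
    obtain ⟨C', D', h⟩ := exists_isRooted_aeval (H := H) (d := d) (φ 0)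
      ((√(d : ℝ))⁻¹ * (((0 : ℕ) + 1) * ∑ α, |x α|)) (0 + 1)
    -- Nonnegativity of `C'` is only available once a neuron exists, which fails for `n = 0`; hence
    -- the absolute value.
    refine ⟨|C'|, D', abs_nonneg _, fun n i => ?_⟩
    have hi := h n (0, i) _ (IsRooted.sum_X_mul (e := fun α => Sum.inl (i, α)) (v := (0, i))
      (a := (√(d : ℝ))⁻¹) (A := (√(d : ℝ))⁻¹) (ω := 0) (δ := 0) (ν := 0)
      (Q := fun α => MvPolynomial.C (x α))
      (fun α β hαβ => by simpa using hαβ) (by simp [abs_of_nonneg]) (fun α => by simp [degWV_apply])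
      (fun α => by simp [degV_apply]) (fun α => rfl) (by positivity)
      (Finset.sum_nonneg fun α _ => abs_nonneg _) fun α =>
        { IsRooted.const _ (x α) with
          abs_coeff_le := fun s => ((IsRooted.const (0, i) (x α)).abs_coeff_le s).trans
            (mul_le_mul_of_nonneg_right (Finset.single_le_sum (f := fun α => |x α|)
              (fun _ _ => abs_nonneg _) (Finset.mem_univ α)) (by positivity)) })
    rw [abs_of_nonneg hi.nonneg]
    exact hi
  | succ ℓ ih =>
    obtain ⟨C, D, hC, hih⟩ := ih
    obtain ⟨C', D', h⟩ := exists_isRooted_aeval (H := H) (d := d) (φ ℓ.succ)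
      (1 * ((D + 1) * C)) (D + 1)
    refine ⟨|C'|, D', abs_nonneg _, fun n i => ?_⟩
    have hi := h n (ℓ.succ, i) _ (IsRooted.sum_X_mul
      (e := fun j => Sum.inr (Sum.inl (ℓ, i, j))) (v := (ℓ.succ, i))
      (a := (√(n : ℝ))⁻¹) (A := 1) (ω := 1) (δ := 0) (ν := 0)
      (Q := fun j => postActPoly φ x ℓ.castSucc j)
      (fun α β hαβ => by simpa using hαβ) (by simp [abs_of_nonneg])
      (fun j => by simp [degWV_apply, Finsupp.single_apply])
      (fun j => by simp [degV_apply]) (fun j => rfl) zero_le_one hC (hih n))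
    rw [abs_of_nonneg hi.nonneg]
    exact hi

theorem exists_isRooted_networkPoly (φ : Fin (H + 1) → ℝ[X]) (x : Fin d → ℝ) :
    ∃ C D, 0 ≤ C ∧ ∀ (n : ℕ), (∀ s, MvPolynomial.coeff s (networkPoly n φ x) ≠ 0 →
      s.degree ≤ D ∧ degV s = 1 ∧ ∃ v, ConnectedTo v s) ∧
      ∀ s, |MvPolynomial.coeff s (networkPoly n φ x)| ≤ C * (√(n : ℝ))⁻¹ ^ degWV s := by
  obtain ⟨C, D, hC, h⟩ := exists_isRooted_postActPoly φ x (Fin.last H)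
  refine ⟨1 * ((D + 1) * C), D + 1, by positivity, fun n => ?_⟩
  obtain ⟨h1, h2⟩ := IsRooted.coeff_sum_X_mul (H := H) (d := d) (n := n)
    (e := fun i => Sum.inr (Sum.inr i)) (a := (√(n : ℝ))⁻¹) (A := 1) (ω := 1) (δ := 1) (ν := 0)
    (Q := fun i => postActPoly φ x (Fin.last H) i)
    (fun α β hαβ => by simpa using hαβ) (by simp [abs_of_nonneg])
    (fun j => by simp [degWV_apply, Finsupp.single_apply])
    (fun j => by simp [degV_apply, Finsupp.single_apply]) zero_le_one hC (h n)
  exact ⟨fun s hs => ⟨(h1 s hs).1, (h1 s hs).2.1, _, (h1 s hs).2.2.choose_spec⟩, h2⟩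

end NetworkPolynomial

/-! ### Derivative tensors of polynomials. -/

section Derivatives

variable {σ : Type}

/-- The iterated partial derivative of a polynomial. -/
def derivPoly (P : MvPolynomial σ ℝ) : (k : ℕ) → (Fin k → σ) → MvPolynomial σ ℝ
  | 0, _ => P
  | k + 1, μ => MvPolynomial.pderiv (μ 0) (derivPoly P k (Fin.tail μ))

theorem hasLineDerivAt_eval [DecidableEq σ] (P : MvPolynomial σ ℝ) (θ : σ → ℝ) (i : σ) :
    HasLineDerivAt ℝ (fun θ => MvPolynomial.eval θ P)
      (MvPolynomial.eval θ (MvPolynomial.pderiv i P)) θ (Pi.single i 1) := by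
  unfold HasLineDerivAt
  induction P using MvPolynomial.induction_on with
  | C a => simpa using hasDerivAt_const (0 : ℝ) a
  | add p q hp hq => simpa using hp.fun_add hq
  | mul_X p j hp =>
    have hj : HasDerivAt (fun t : ℝ => θ j + t * (Pi.single i (1 : ℝ) : σ → ℝ) j)
        ((Pi.single i (1 : ℝ) : σ → ℝ) j) 0 := by
      simpa using ((hasDerivAt_id (0 : ℝ)).mul_const _).const_add (θ j)
    have h := hp.mul hj
    simp only [zero_smul, zero_mul, add_zero] at h
    simp only [MvPolynomial.eval_mul, MvPolynomial.eval_X, Pi.add_apply, Pi.smul_apply,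
      smul_eq_mul, Derivation.leibniz, MvPolynomial.pderiv_X, map_add]
    refine h.congr_deriv ?_
    rw [add_comm, mul_comm _ (θ j)]
    congr 2
    rcases eq_or_ne j i with rfl | hji
    · simp
    · simp [hji]

theorem derivTensor_eval [DecidableEq σ] (P : MvPolynomial σ ℝ) (k : ℕ) (μ : Fin k → σ) :
    derivTensor (fun θ => MvPolynomial.eval θ P) k μ =
      fun θ => MvPolynomial.eval θ (derivPoly P k μ) := by
  induction k with
  | zero => rfl
  | succ k ih =>
    ext θ
    rw [derivTensor, ih]
    exact (hasLineDerivAt_eval _ θ (μ 0)).lineDeriv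

/-- Each differentiation multiplies a coefficient by an exponent of the monomial it came from, which
is at most `D` when that coefficient is nonzero. -/
theorem abs_coeff_derivPoly_le {P : MvPolynomial σ ℝ} {D : ℕ}
    (hD : ∀ s, MvPolynomial.coeff s P ≠ 0 → s.degree ≤ D) (k : ℕ) (μ : Fin k → σ) (s : σ →₀ ℕ) :
    |MvPolynomial.coeff s (derivPoly P k μ)| ≤
      (D : ℝ) ^ k * |MvPolynomial.coeff (s + ∑ a, Finsupp.single (μ a) 1) P| := by
  induction k generalizing s with
  | zero => simp [derivPoly]
  | succ k ih =>
    rw [derivPoly, MvPolynomial.coeff_pderiv, abs_mul, Fin.sum_univ_succ, ← add_assoc]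
    refine (mul_le_mul_of_nonneg_right (ih (Fin.tail μ) _) (abs_nonneg _)).trans ?_
    change _ * |MvPolynomial.coeff (s + Finsupp.single (μ 0) 1 +
      ∑ a : Fin k, Finsupp.single (μ a.succ) 1) P| * _ ≤ _
    set c := MvPolynomial.coeff (s + Finsupp.single (μ 0) 1 +
      ∑ a : Fin k, Finsupp.single (μ a.succ) 1) P with hc
    by_cases h0 : c = 0
    · simp [h0]
    · have hs : s (μ 0) + 1 ≤ D := by
        refine le_trans ?_ (hD _ h0)
        rw [map_add, map_add, Finsupp.degree_single]
        have := Finsupp.le_degree (μ 0) s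
        omega
      have hs' : |(s (μ 0) : ℝ) + 1| ≤ D := by
        rw [abs_of_nonneg (by positivity)]
        exact_mod_cast hs
      calc _ ≤ (D : ℝ) ^ k * |c| * D := by gcongr
        _ = _ := by ring

end Derivatives

/-! ### Gaussian moments and covariances of monomials. -/

section Moments

/-- The monomial function with exponents `s`. -/
def monom {σ : Type*} [Fintype σ] (s : σ →₀ ℕ) (θ : σ → ℝ) : ℝ := ∏ p, θ p ^ s p

theorem monom_mul_monom {σ : Type*} [Fintype σ] (s t : σ →₀ ℕ) :
    monom s * monom t = monom (s + t) := by
  ext θ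
  simp [monom, Finset.prod_mul_distrib, pow_add]

/-- The moments of the standard Gaussian. -/
def gaussMoment (k : ℕ) : ℝ := ∫ x, x ^ k ∂gaussianReal 0 1

theorem gaussMoment_zero : gaussMoment 0 = 1 := by simp [gaussMoment]

theorem gaussMoment_odd {k : ℕ} (hk : Odd k) : gaussMoment k = 0 := by
  have h : gaussMoment k = -gaussMoment k := by
    -- Writing the mean as `-0` exhibits the Gaussian law as its own reflection.
    conv_lhs => rw [gaussMoment, ← neg_zero, ← gaussianReal_map_neg]
    rw [integral_map (by fun_prop) (by fun_prop), gaussMoment, ← integral_neg]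
    simp [hk.neg_pow]
  linarith

theorem integrable_pow_gaussianReal (k : ℕ) :
    Integrable (fun x : ℝ => x ^ k) (gaussianReal 0 1) := by
  have h := (memLp_id_gaussianReal (μ := 0) (v := 1) k).integrable_norm_pow'
  refine (integrable_norm_iff (by fun_prop)).1 ?_
  simpa using h

variable {H d n : ℕ}

instance : IsProbabilityMeasure (initLaw H d n) := by
  unfold initLaw; infer_instance

theorem integral_monom (s : Param H d n →₀ ℕ) :
    ∫ θ, monom s θ ∂initLaw H d n = ∏ p, gaussMoment (s p) := by
  simp only [monom, initLaw, gaussMoment]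
  exact integral_fintype_prod_eq_prod (fun p (x : ℝ) => x ^ s p)

theorem integrable_monom (s : Param H d n →₀ ℕ) : Integrable (monom s) (initLaw H d n) :=
  Integrable.fintype_prod (f := fun p (x : ℝ) => x ^ s p) fun p => integrable_pow_gaussianReal (s p)

theorem memLp_monom (s : Param H d n →₀ ℕ) : MemLp (monom s) 2 (initLaw H d n) := by
  refine (memLp_two_iff_integrable_sq (integrable_monom s).aestronglyMeasurable).2 ?_
  have h := integrable_monom (s + s)
  rw [← monom_mul_monom] at h
  exact h.congr (.of_forall fun θ => (sq _).symm)

theorem covariance_monom (s t : Param H d n →₀ ℕ) :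
    cov[monom s, monom t; initLaw H d n] =
      ∏ p, gaussMoment ((s + t) p) - (∏ p, gaussMoment (s p)) * ∏ p, gaussMoment (t p) := by
  rw [covariance_eq_sub (memLp_monom s) (memLp_monom t), monom_mul_monom, integral_monom,
    integral_monom, integral_monom]

/-- An odd total exponent at `p` kills the joint moment, and also one of the two separate moments,
since exactly one of the exponents is odd. -/
theorem even_of_covariance_monom_ne_zero {s t : Param H d n →₀ ℕ}
    (h : cov[monom s, monom t; initLaw H d n] ≠ 0) (p : Param H d n) : Even (s p + t p) := by
  by_contra hp
  rw [Nat.not_even_iff_odd] at hp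
  refine h ?_
  rw [covariance_monom, Finset.prod_eq_zero (Finset.mem_univ p), zero_sub, neg_eq_zero]
  · rcases Nat.even_or_odd (s p) with hs | hs
    · rw [Finset.prod_eq_zero (Finset.mem_univ p) (f := fun p => gaussMoment (t p)), mul_zero]
      exact gaussMoment_odd ((Nat.odd_add'.1 hp).2 hs)
    · rw [Finset.prod_eq_zero (Finset.mem_univ p) (gaussMoment_odd hs), zero_mul]
  · exact gaussMoment_odd hp

/-- Monomials in disjoint sets of parameters are independent: at each `p` one exponent is zero, so
the joint moment factors. -/
theorem exists_common_of_covariance_monom_ne_zero {s t : Param H d n →₀ ℕ}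
    (h : cov[monom s, monom t; initLaw H d n] ≠ 0) : ∃ p, s p ≠ 0 ∧ t p ≠ 0 := by
  by_contra! hp
  refine h ?_
  rw [covariance_monom, ← Finset.prod_mul_distrib, sub_eq_zero]
  refine Finset.prod_congr rfl fun p _ => ?_
  by_cases hs : s p = 0
  · simp [hs, gaussMoment_zero]
  · simp [hp p hs, gaussMoment_zero]

theorem abs_prod_gaussMoment_le {s : Param H d n →₀ ℕ} {D : ℕ} (hs : s.degree ≤ D) :
    |∏ p, gaussMoment (s p)| ≤ (∑ k ∈ Finset.range (D + 1), |gaussMoment k|) ^ D := by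
  set M := ∑ k ∈ Finset.range (D + 1), |gaussMoment k| with hM
  have hle : ∀ k ≤ D, |gaussMoment k| ≤ M := fun k hk =>
    Finset.single_le_sum (f := fun k => |gaussMoment k|) (fun _ _ => abs_nonneg _)
      (Finset.mem_range.2 (Nat.lt_succ_of_le hk))
  have hM1 : 1 ≤ M := by simpa [gaussMoment_zero] using hle 0 (Nat.zero_le _)
  rw [← Finset.prod_subset (Finset.subset_univ s.support), Finset.abs_prod]
  · calc ∏ p ∈ s.support, |gaussMoment (s p)| ≤ ∏ p ∈ s.support, M :=
          Finset.prod_le_prod (fun _ _ => abs_nonneg _) fun p _ =>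
            hle _ ((Finsupp.le_degree p s).trans hs)
      _ = M ^ s.support.card := Finset.prod_const _
      _ ≤ M ^ D := pow_le_pow_right₀ hM1 ((card_support_le_degree s).trans hs)
  · intro p _ hp
    rw [Finsupp.notMem_support_iff.1 hp, gaussMoment_zero]

theorem exists_abs_covariance_monom_le (D : ℕ) : ∃ M : ℝ, 0 ≤ M ∧
    ∀ (n : ℕ) (s t : Param H d n →₀ ℕ), s.degree ≤ D → t.degree ≤ D →
      |cov[monom s, monom t; initLaw H d n]| ≤ M := by
  set M : ℕ → ℝ := fun D => (∑ k ∈ Finset.range (D + 1), |gaussMoment k|) ^ D with hM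
  have hM0 : ∀ D, 0 ≤ M D := fun D =>
    pow_nonneg (Finset.sum_nonneg fun _ _ => abs_nonneg _) _
  refine ⟨M (D + D) + M D * M D, add_nonneg (hM0 _) (mul_nonneg (hM0 _) (hM0 _)),
    fun n s t hs ht => ?_⟩
  rw [covariance_monom]
  refine (abs_sub _ _).trans (add_le_add (abs_prod_gaussMoment_le ?_) ?_)
  · rw [map_add]; exact add_le_add hs ht
  · rw [abs_mul]
    exact mul_le_mul (abs_prod_gaussMoment_le hs) (abs_prod_gaussMoment_le ht) (abs_nonneg _)
      (hM0 _)

end Moments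

/-! ### Expansion of a product of derivative tensors over configurations. -/

section Expansion

variable {H d n : ℕ}

/-- A choice of the summation indices and of a monomial from each derivative tensor. -/
abbrev Config (S : TensorProductShape) (H d n : ℕ) : Type :=
  (Fin S.r → Param H d n) × (Fin S.m → Param H d n →₀ ℕ)

namespace TensorProductShape

variable (S : TensorProductShape)

/-- The monomial of the network function from which the chosen monomial of the `K`-th derivative
tensor arises by differentiation. -/
def fullMonom (z : Config S H d n) (K : Fin S.m) : Param H d n →₀ ℕ :=
  z.2 K + ∑ a, Finsupp.single (z.1 (S.idx K a)) 1

theorem sum_fullMonom (z : Config S H d n) :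
    ∑ K, S.fullMonom z K = ∑ K, z.2 K + 2 • ∑ s, Finsupp.single (z.1 s) 1 := by
  simp only [fullMonom, Finset.sum_add_distrib]
  congr 1
  rw [← Fintype.sum_sigma' (fun (K : Fin S.m) (a : Fin (S.k K)) =>
    (Finsupp.single (z.1 (S.idx K a)) 1 : Param H d n →₀ ℕ)),
    ← Finset.sum_fiberwise Finset.univ
      (fun p : (K : Fin S.m) × Fin (S.k K) => S.idx p.1 p.2), Finset.smul_sum]
  refine Finset.sum_congr rfl fun s _ => ?_
  rw [← S.paired s, ← Finset.sum_const]
  refine Finset.sum_congr rfl fun p hp => ?_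
  rw [(Finset.mem_filter.1 hp).2]

/-- Every summation index fills two slots, so restoring the differentiated parameters changes each
exponent by an even amount. -/
theorem even_sum_fullMonom_iff (z : Config S H d n) (p : Param H d n) :
    Even (∑ K, S.fullMonom z K p) ↔ Even (∑ K, z.2 K p) := by
  rw [← Finsupp.finsetSum_apply, sum_fullMonom, Finsupp.add_apply, Finsupp.finsetSum_apply,
    Finsupp.smul_apply, Nat.even_add]
  simp

/-- The monomials with exponents at most `D`. -/
def boxMonoms (H d n D : ℕ) : Finset (Param H d n →₀ ℕ) :=
  Finset.univ.finsupp fun _ => Finset.range (D + 1)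

theorem mem_boxMonoms {D : ℕ} {s : Param H d n →₀ ℕ} (hs : s.degree ≤ D) :
    s ∈ boxMonoms H d n D := by
  refine Finset.mem_finsupp_iff.2 ⟨Finset.subset_univ _, fun p _ => ?_⟩
  exact Finset.mem_range.2 (Nat.lt_succ_of_le ((Finsupp.le_degree p s).trans hs))

/-- The configurations with exponents at most `D`. -/
def boxConfigs (H d n D : ℕ) : Finset (Config S H d n) :=
  Finset.univ ×ˢ Fintype.piFinset fun _ => boxMonoms H d n D

/-- The monomials of the network function chosen in `z` could occur in it. -/
def Admissible (D : ℕ) (z : Config S H d n) : Prop :=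
  ∀ K, (S.fullMonom z K).degree ≤ D ∧ degV (S.fullMonom z K) = 1 ∧
    ∃ v, ConnectedTo v (S.fullMonom z K)

theorem exists_expansion (φ : Fin (H + 1) → ℝ[X]) (x : Fin S.m → Fin d → ℝ) :
    ∃ (C : ℝ) (D : ℕ), 0 ≤ C ∧ ∀ n, ∃ b : Config S H d n → ℝ,
      (S.eval φ x n = fun θ => ∑ z ∈ S.boxConfigs H d n D, b z * monom (∑ K, z.2 K) θ) ∧
      (∀ z, b z ≠ 0 → S.Admissible D z) ∧
      ∀ z, |b z| ≤ C * (√(n : ℝ))⁻¹ ^ degWV (∑ K, S.fullMonom z K) := by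
  choose C D' hC h using fun K => exists_isRooted_networkPoly φ (x K)
  let D := ∑ K, D' K
  have hD : ∀ K, D' K ≤ D := fun K =>
    Finset.single_le_sum (f := D') (fun _ _ => Nat.zero_le _) (Finset.mem_univ K)
  refine ⟨∏ K, ((D : ℝ) ^ S.k K * C K), D, Finset.prod_nonneg fun K _ =>
    mul_nonneg (by positivity) (hC K), fun n => ?_⟩
  let Q : (Fin S.r → Param H d n) → Fin S.m → MvPolynomial (Param H d n) ℝ := fun μ K =>
    derivPoly (networkPoly n φ (x K)) (S.k K) fun a => μ (S.idx K a)
  have hdeg : ∀ K s, MvPolynomial.coeff s (networkPoly n φ (x K)) ≠ 0 → s.degree ≤ D :=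
    fun K s hs => (((h K n).1 s hs).1).trans (hD K)
  have hcoeff : ∀ (z : Config S H d n) K, |MvPolynomial.coeff (z.2 K) (Q z.1 K)| ≤
      (D : ℝ) ^ S.k K * |MvPolynomial.coeff (S.fullMonom z K) (networkPoly n φ (x K))| :=
    fun z K => abs_coeff_derivPoly_le (hdeg K) _ _ _
  have hne : ∀ (z : Config S H d n) K, MvPolynomial.coeff (z.2 K) (Q z.1 K) ≠ 0 →
      MvPolynomial.coeff (S.fullMonom z K) (networkPoly n φ (x K)) ≠ 0 := by
    intro z K hz h0
    have := hcoeff z K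
    rw [h0, abs_zero, mul_zero] at this
    exact hz (abs_nonpos_iff.1 this)
  refine ⟨fun z => ∏ K, MvPolynomial.coeff (z.2 K) (Q z.1 K), ?_, fun z hz K => ?_, fun z => ?_⟩
  · ext θ
    rw [eval, boxConfigs, Finset.sum_product]
    refine Finset.sum_congr rfl fun μ _ => ?_
    have hK : ∀ K, derivTensor (network φ (x K)) (S.k K) (fun a => μ (S.idx K a)) θ =
        ∑ s ∈ boxMonoms H d n D, MvPolynomial.coeff s (Q μ K) * monom s θ := by
      intro K
      rw [← eval_networkPoly, derivTensor_eval]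
      simp only
      rw [MvPolynomial.eval_eq']
      -- A monomial of the derivative divides a monomial of the network function, so its degree is
      -- at most `D`; the surplus monomials of the box have coefficient zero.
      refine Finset.sum_subset (fun s hs => mem_boxMonoms ?_) fun s _ hs => ?_
      · have h1 := hdeg K _ (hne (μ, fun _ => s) K (MvPolynomial.mem_support_iff.1 hs))
        rw [fullMonom, map_add] at h1
        exact (Nat.le_add_right _ _).trans h1
      · rw [MvPolynomial.notMem_support_iff.1 hs, zero_mul]
    rw [Finset.prod_congr rfl fun K _ => hK K, Finset.prod_univ_sum]
    refine Finset.sum_congr rfl fun σ _ => ?_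
    rw [Finset.prod_mul_distrib]
    congr 1
    simp only [monom, Finsupp.finsetSum_apply, ← Finset.prod_pow_eq_pow_sum]
    exact Finset.prod_comm
  · have h1 := hne z K (Finset.prod_ne_zero_iff.1 hz K (Finset.mem_univ K))
    exact ⟨hdeg K _ h1, ((h K n).1 _ h1).2⟩
  · rw [Finset.abs_prod, map_sum, ← Finset.prod_pow_eq_pow_sum, ← Finset.prod_mul_distrib]
    refine Finset.prod_le_prod (fun _ _ => abs_nonneg _) fun K _ => (hcoeff z K).trans ?_
    rw [mul_assoc]
    exact mul_le_mul_of_nonneg_left ((h K n).2 _) (by positivity)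

end TensorProductShape

end Expansion

namespace TensorProductShape

/-! ### The power-counting inequality. -/

section Exponent

-- The weight of a cluster is the least positive integer with the parity of its size, as needed in
-- `two_mul_card_le_sum_of_even_fibers`.
open scoped Classical in
theorem sum_component_weight (S : TensorProductShape) :
    ∑ c : S.clusterGraph.ConnectedComponent, (if Even c.supp.ncard then 2 else 1) =
      2 * S.nEven + S.nOdd := by
  have h1 : S.nEven = (Finset.univ.filter fun c : S.clusterGraph.ConnectedComponent =>
      Even c.supp.ncard).card := by
    rw [nEven, Set.ncard_eq_toFinset_card']; congr 1; ext c; simp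
  have h2 : S.nOdd = (Finset.univ.filter fun c : S.clusterGraph.ConnectedComponent =>
      ¬ Even c.supp.ncard).card := by
    rw [nOdd, Set.ncard_eq_toFinset_card']; congr 1; ext c; simp
  rw [Finset.sum_ite, Finset.sum_const, Finset.sum_const, ← h1, ← h2]
  simp [mul_comm]

open scoped Classical in
theorem card_component (S : TensorProductShape) :
    Fintype.card S.clusterGraph.ConnectedComponent = S.nEven + S.nOdd := by
  rw [nEven, nOdd, Set.ncard_eq_toFinset_card', Set.ncard_eq_toFinset_card', ← Finset.card_univ,
    ← Finset.card_filter_add_card_filter_not (fun c => Even c.supp.ncard)]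
  congr 2 <;> ext c <;> simp

variable {H d n : ℕ}

theorem fullMonom_idx_ne_zero (S : TensorProductShape) (z : Config S H d n) (K : Fin S.m)
    (a : Fin (S.k K)) : S.fullMonom z K (z.1 (S.idx K a)) ≠ 0 := by
  rw [fullMonom, Finsupp.add_apply, Finsupp.finsetSum_apply]
  have := Finset.single_le_sum (f := fun b : Fin (S.k K) =>
    (Finsupp.single (z.1 (S.idx K b)) 1 : Param H d n →₀ ℕ) (z.1 (S.idx K a)))
    (fun _ _ => Nat.zero_le _) (Finset.mem_univ a)
  simp only [Finsupp.single_eq_same] at this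
  omega

/-- Tensors adjacent in the cluster graph share a summation index, whose value is a parameter of
both full monomials. Every cluster therefore lies inside one class, whatever the configuration. -/
theorem eq_of_reachable (S : TensorProductShape) {z : Config S H d n} {β : Type*}
    {f : Fin S.m → β} (hf : ∀ J K, SharesParam (S.fullMonom z) J K → f J = f K) {J K : Fin S.m}
    (h : S.clusterGraph.Reachable J K) : f J = f K := by
  obtain ⟨p⟩ := h
  induction p with
  | nil => rfl
  | cons hadj _ ih =>
    refine (hf _ _ ?_).trans ih
    obtain ⟨-, a, b, hab⟩ := hadj
    refine ⟨_, S.fullMonom_idx_ne_zero z _ a, ?_⟩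
    rw [hab]
    exact S.fullMonom_idx_ne_zero z _ b

/-- The product of all monomials of the network function in a pair of configurations. -/
def pairMonom (S T : TensorProductShape) (z : Config S H d n × Config T H d n) :
    Param H d n →₀ ℕ :=
  ∑ K, S.fullMonom z.1 K + ∑ K, T.fullMonom z.2 K

theorem pairMonom_ne_zero_left (S T : TensorProductShape) {z : Config S H d n × Config T H d n}
    {K : Fin S.m} {p : Param H d n} (h : S.fullMonom z.1 K p ≠ 0) : pairMonom S T z p ≠ 0 := by
  intro h0
  rw [pairMonom, Finsupp.add_apply, Nat.add_eq_zero_iff, Finsupp.finsetSum_apply,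
    Finset.sum_eq_zero_iff] at h0
  exact h (h0.1 K (Finset.mem_univ K))

theorem pairMonom_comm (S T : TensorProductShape) (z : Config S H d n × Config T H d n) :
    pairMonom T S z.swap = pairMonom S T z := add_comm _ _

theorem exponent_bound (S T : TensorProductShape) {D D' : ℕ}
    {z : Config S H d n × Config T H d n} (hS : S.Admissible D z.1) (hT : T.Admissible D' z.2)
    (heven : ∀ p, Even ((∑ K, z.1.2 K) p + (∑ K, z.2.2 K) p))
    (hcommon : ∃ p, (∑ K, z.1.2 K) p ≠ 0 ∧ (∑ K, z.2.2 K) p ≠ 0) :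
    Even (S.nOdd + T.nOdd) ∧
      2 * ((neurons (pairMonom S T z)).card : ℝ) ≤ degWV (pairMonom S T z) + 2 * sV S T := by
  classical
  let t : Fin S.m ⊕ Fin T.m → Param H d n →₀ ℕ := Sum.elim (S.fullMonom z.1) (T.fullMonom z.2)
  have : Fintype (Quot (SharesParam t)) := Fintype.ofFinite _
  have htot : ∑ K, t K = pairMonom S T z := by simp [t, pairMonom]
  have hV : ∀ K, degV (t K) = 1 := by
    rintro (K | K)
    exacts [(hS K).2.1, (hT K).2.1]
  have hc : ∀ K, ∃ v, ConnectedTo v (t K) := by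
    rintro (K | K)
    exacts [(hS K).2.2, (hT K).2.2]
  have hev : ∀ p, Even (∑ K, t K p) := by
    intro p
    have := heven p
    simp only [Fintype.sum_sum_type, t, Sum.elim_inl, Sum.elim_inr]
    rw [Nat.even_add, S.even_sum_fullMonom_iff, T.even_sum_fullMonom_iff, ← Nat.even_add]
    simpa [Finsupp.finsetSum_apply] using this
  -- `f` sends a tensor to its cluster and `g` a cluster to its class, for the two products jointly.
  let f : Fin S.m ⊕ Fin T.m →
      S.clusterGraph.ConnectedComponent ⊕ T.clusterGraph.ConnectedComponent :=
    Sum.map S.clusterGraph.connectedComponentMk T.clusterGraph.connectedComponentMk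
  let g : S.clusterGraph.ConnectedComponent ⊕ T.clusterGraph.ConnectedComponent →
      Quot (SharesParam t) :=
    Sum.elim
      (Quot.lift (fun K => Quot.mk _ (Sum.inl K)) fun J K h =>
        S.eq_of_reachable (z := z.1) (f := fun K => Quot.mk (SharesParam t) (Sum.inl K))
          (fun J K h => Quot.sound h) h)
      (Quot.lift (fun K => Quot.mk _ (Sum.inr K)) fun J K h =>
        T.eq_of_reachable (z := z.2) (f := fun K => Quot.mk (SharesParam t) (Sum.inr K))
          (fun J K h => Quot.sound h) h)
  have hgf : ∀ K, g (f K) = Quot.mk _ K := by rintro (K | K) <;> rfl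
  have hg : Function.Surjective g := fun c => by
    induction c using Quot.ind with
    | mk K => exact ⟨f K, hgf K⟩
  have hfib : ∀ c, Even (Finset.univ.filter fun K => g (f K) = c).card := by
    intro c
    simp only [hgf]
    exact even_card_quot_fiber hV hev c
  let w : S.clusterGraph.ConnectedComponent ⊕ T.clusterGraph.ConnectedComponent → ℕ :=
    Sum.elim (fun c => if Even c.supp.ncard then 2 else 1)
      (fun c => if Even c.supp.ncard then 2 else 1)
  have hwsum : ∑ q, w q = 2 * S.nEven + S.nOdd + (2 * T.nEven + T.nOdd) := by
    rw [Fintype.sum_sum_type, ← sum_component_weight, ← sum_component_weight]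
    rfl
  have hpar : ∀ q, Even (w q + (Finset.univ.filter fun K => f K = q).card) := by
    rintro (c | c)
    · have : (Finset.univ.filter fun K => f K = Sum.inl c).card = c.supp.ncard := by
        rw [Set.ncard_eq_toFinset_card']
        refine (Finset.card_bij (fun K _ => Sum.inl K) ?_ ?_ ?_).symm
        · simp [f]
        · simp
        · rintro (K | K) <;> simp [f]
      rw [this]
      simp only [w, Sum.elim_inl]
      split_ifs with h
      · exact even_two.add h
      · exact odd_one.add_odd (Nat.not_even_iff_odd.1 h)
    · have : (Finset.univ.filter fun K => f K = Sum.inr c).card = c.supp.ncard := by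
        rw [Set.ncard_eq_toFinset_card']
        refine (Finset.card_bij (fun K _ => Sum.inr K) ?_ ?_ ?_).symm
        · simp [f]
        · simp
        · rintro (K | K) <;> simp [f]
      rw [this]
      simp only [w, Sum.elim_inr]
      split_ifs with h
      · exact even_two.add h
      · exact odd_one.add_odd (Nat.not_even_iff_odd.1 h)
  have hw1 : ∀ q, 1 ≤ w q := by
    rintro (c | c) <;> simp only [w, Sum.elim_inl, Sum.elim_inr] <;> split_ifs <;> omega
  have hclasses := two_mul_card_le_sum_of_even_fibers f g hg hfib w hw1 hpar
  have hneurons := two_mul_card_neurons_add_card_le hV hc hev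
  rw [htot, Fintype.card_sum, Fintype.card_fin, Fintype.card_fin] at hneurons
  rw [hwsum] at hclasses
  refine ⟨?_, ?_⟩
  -- All classes are even, so the number of tensors is even; modulo 2 it equals the total weight,
  -- and hence the number of odd clusters.
  · have hcard : Even (Fintype.card (Fin S.m ⊕ Fin T.m)) := by
      rw [← Finset.card_univ, Finset.card_eq_sum_card_fiberwise (f := fun K => g (f K))
        (t := Finset.univ) (fun _ _ => Finset.mem_coe.2 (Finset.mem_univ _))]
      exact Finset.even_sum _ fun c _ => hfib c
    have hsum : Even (∑ q, (w q + (Finset.univ.filter fun K => f K = q).card)) :=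
      Finset.even_sum _ fun q _ => hpar q
    rw [Finset.sum_add_distrib, ← Finset.card_eq_sum_card_fiberwise (f := f) (s := Finset.univ)
        (t := Finset.univ) (fun _ _ => Finset.mem_coe.2 (Finset.mem_univ _)), Finset.card_univ,
      Nat.even_add, hwsum] at hsum
    obtain ⟨k, hk⟩ := hsum.2 hcard
    exact ⟨k - S.nEven - T.nEven, by omega⟩
  · have hR : 2 * ((neurons (pairMonom S T z)).card : ℝ) + (S.m + T.m) ≤
        degWV (pairMonom S T z) + 2 * Fintype.card (Quot (SharesParam t)) := by
      exact_mod_cast hneurons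
    unfold sV sC
    split_ifs with h0
    -- The common parameter puts a cluster of `S` and a cluster of `T` in the same class, so there
    -- is at least one class fewer than there are clusters.
    · have hlt : Fintype.card (Quot (SharesParam t)) + 1 ≤ S.nEven + T.nEven := by
        have := Fintype.card_lt_of_surjective_not_injective g hg ?_
        · rw [Fintype.card_sum, card_component, card_component] at this
          omega
        · obtain ⟨p, hp, hp'⟩ := hcommon
          rw [Finsupp.finsetSum_apply] at hp hp'
          obtain ⟨J, -, hJ⟩ := Finset.exists_ne_zero_of_sum_ne_zero hp
          obtain ⟨K, -, hK⟩ := Finset.exists_ne_zero_of_sum_ne_zero hp'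
          intro hinj
          have h1 : g (f (Sum.inl J)) = g (f (Sum.inr K)) := by
            rw [hgf, hgf]
            refine Quot.sound ⟨p, ?_, ?_⟩
            · simp [t, fullMonom, hJ]
            · simp [t, fullMonom, hK]
          exact absurd (hinj h1) (by simp [f])
      have hlt' : (Fintype.card (Quot (SharesParam t)) : ℝ) + 1 ≤ S.nEven + T.nEven := by
        exact_mod_cast hlt
      have hS0 : S.nOdd = 0 := by omega
      have hT0 : T.nOdd = 0 := by omega
      rw [hS0, hT0, Nat.cast_zero]
      linarith
    · have hclasses' : 2 * (Fintype.card (Quot (SharesParam t)) : ℝ) ≤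
          2 * S.nEven + S.nOdd + (2 * T.nEven + T.nOdd) := by
        exact_mod_cast hclasses
      linarith

end Exponent

/-! ### Counting configurations by their set of neurons. -/

section Counting

variable {H d n : ℕ}

/-- The parameters both of whose neurons lie in `A`. -/
def paramsIn (d : ℕ) (A : Finset (Neuron H n)) : Finset (Param H d n) :=
  Finset.univ.filter fun p => outNeuron p ∈ A ∧ inNeuron p ∈ A

/-- A parameter is determined by its two neurons and a tag: one of the `d` input coordinates for
`U`, or the type `W` or `V`. -/
theorem card_paramsIn_le (A : Finset (Neuron H n)) :
    (paramsIn d A).card ≤ A.card * A.card * (d + 2) := by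
  let tag : Param H d n → Option (Option (Fin d)) :=
    Sum.elim (fun p => some (some p.2)) (Sum.elim (fun _ => some none) fun _ => none)
  have hcard : ((A ×ˢ A) ×ˢ (Finset.univ : Finset (Option (Option (Fin d))))).card =
      A.card * A.card * (d + 2) := by
    simp [Finset.card_product]
  rw [← hcard]
  refine Finset.card_le_card_of_injOn (fun p => ((outNeuron p, inNeuron p), tag p)) ?_ ?_
  · intro p hp
    simpa [paramsIn] using hp
  · rintro (⟨i, α⟩ | ⟨ℓ, i, j⟩ | i) - (⟨i', α'⟩ | ⟨ℓ', i', j'⟩ | i') - h <;>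
      simp_all [outNeuron, inNeuron, tag]

/-- The configurations with exponents at most `D` all of whose neurons lie in `A`. -/
def configsIn (S : TensorProductShape) (d D : ℕ) (A : Finset (Neuron H n)) :
    Finset (Config S H d n) :=
  (Fintype.piFinset fun _ => paramsIn d A) ×ˢ
    Fintype.piFinset fun _ => (paramsIn d A).finsupp fun _ => Finset.range (D + 1)

theorem card_configsIn_le (S : TensorProductShape) (D B : ℕ) {A : Finset (Neuron H n)}
    (hA : A.card ≤ B) :
    (configsIn S d D A).card ≤
      (B * B * (d + 2)) ^ S.r * ((D + 1) ^ (B * B * (d + 2))) ^ S.m := by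
  have h : (paramsIn d A).card ≤ B * B * (d + 2) := (card_paramsIn_le A).trans (by gcongr)
  simp only [configsIn, Finset.card_product, Fintype.card_piFinset, Finset.prod_const,
    Finset.card_univ, Fintype.card_fin, Finset.card_finsupp, Finset.card_range]
  gcongr
  exact Nat.succ_le_succ (Nat.zero_le _)

theorem mem_configsIn (S : TensorProductShape) {D : ℕ} {A : Finset (Neuron H n)}
    {z : Config S H d n} (hz : z ∈ S.boxConfigs H d n D)
    (hA : ∀ K p, S.fullMonom z K p ≠ 0 → outNeuron p ∈ A ∧ inNeuron p ∈ A) :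
    z ∈ configsIn S d D A := by
  have hmem : ∀ K p, S.fullMonom z K p ≠ 0 → p ∈ paramsIn d A := fun K p hp =>
    Finset.mem_filter.2 ⟨Finset.mem_univ _, hA K p hp⟩
  refine Finset.mem_product.2 ⟨Fintype.mem_piFinset.2 fun s => ?_,
    Fintype.mem_piFinset.2 fun K => Finset.mem_finsupp_iff.2 ⟨fun p hp => ?_, fun p _ => ?_⟩⟩
  · obtain ⟨⟨K, a⟩, hp⟩ : (Finset.univ.filter fun p : (K : Fin S.m) × Fin (S.k K) =>
        S.idx p.1 p.2 = s).Nonempty := by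
      rw [← Finset.card_pos, S.paired s]; exact two_pos
    rw [← (Finset.mem_filter.1 hp).2]
    exact hmem K _ (S.fullMonom_idx_ne_zero z K a)
  · refine hmem K p ?_
    have := Finsupp.mem_support_iff.1 hp
    simp [fullMonom, this]
  · have h := Fintype.mem_piFinset.1 (Finset.mem_product.1 hz).2 K
    exact (Finset.mem_finsupp_iff.1 h).2 p (Finset.mem_univ p)

/-- By the binomial theorem the sum is `(1 + 1/n)^(m n)`. The weight `1/n` per neuron exactly pays
for the choice of that neuron. -/
theorem sum_inv_pow_card_le (m n : ℕ) (hn : 0 < n) :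
    ∑ A : Finset (Fin m × Fin n), ((n : ℝ)⁻¹) ^ A.card ≤ Real.exp m := by
  have h := Finset.sum_pow_mul_eq_add_pow ((n : ℝ)⁻¹) 1 (Finset.univ : Finset (Fin m × Fin n))
  simp only [one_pow, mul_one, Finset.powerset_univ, Finset.card_univ, Fintype.card_prod,
    Fintype.card_fin] at h
  rw [h]
  calc ((n : ℝ)⁻¹ + 1) ^ (m * n) ≤ Real.exp ((n : ℝ)⁻¹) ^ (m * n) := by
        gcongr
        exact Real.add_one_le_exp _
    _ = Real.exp m := by
        rw [← Real.exp_nat_mul]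
        congr 1
        push_cast
        field_simp

theorem exists_sum_inv_pow_card_neurons_le (S T : TensorProductShape) (H d D D' B : ℕ) :
    ∃ N : ℝ, ∀ n : ℕ, 0 < n →
      ∑ z ∈ S.boxConfigs H d n D ×ˢ T.boxConfigs H d n D' with
        (neurons (pairMonom S T z)).card ≤ B,
        ((n : ℝ)⁻¹) ^ (neurons (pairMonom S T z)).card ≤ N := by
  let N : TensorProductShape → ℕ → ℕ := fun S D =>
    (B * B * (d + 2)) ^ S.r * ((D + 1) ^ (B * B * (d + 2))) ^ S.m
  refine ⟨((N S D * N T D' : ℕ) : ℝ) * Real.exp ((H + 1 : ℕ) : ℝ), fun n hn => ?_⟩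
  -- Grouping by the neuron set `A` makes the summand constant on each group, and the size of a
  -- group is bounded in terms of `B` alone.
  rw [← Finset.sum_fiberwise _ fun z => neurons (pairMonom S T z)]
  refine le_trans (Finset.sum_le_sum fun A _ => ?_) (le_trans (Finset.mul_sum _ _ _).ge
    (mul_le_mul_of_nonneg_left (sum_inv_pow_card_le (H + 1) n hn) (Nat.cast_nonneg _)))
  rw [Finset.sum_congr rfl fun z hz => by rw [(Finset.mem_filter.1 hz).2], Finset.sum_const,
    nsmul_eq_mul]
  refine mul_le_mul_of_nonneg_right (Nat.cast_le.2 ?_) (by positivity)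
  by_cases hA : A.card ≤ B
  · refine le_trans (Finset.card_le_card (t := configsIn S d D A ×ˢ configsIn T d D' A) ?_) ?_
    · intro z hz
      simp only [Finset.mem_filter, Finset.mem_product] at hz
      obtain ⟨⟨⟨hzS, hzT⟩, -⟩, rfl⟩ := hz
      refine Finset.mem_product.2 ⟨mem_configsIn S hzS fun K p hp => ?_,
        mem_configsIn T hzT fun K p hp => ?_⟩
      · have := pairMonom_ne_zero_left S T hp
        exact ⟨outNeuron_mem_neurons this, inNeuron_mem_neurons this⟩
      · have := pairMonom_ne_zero_left T S (z := z.swap) hp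
        rw [pairMonom_comm] at this
        exact ⟨outNeuron_mem_neurons this, inNeuron_mem_neurons this⟩
    · rw [Finset.card_product]
      exact Nat.mul_le_mul (card_configsIn_le S D B hA) (card_configsIn_le T D' B hA)
  · rw [Finset.card_eq_zero.2]
    · exact Nat.zero_le _
    · refine Finset.filter_eq_empty_iff.2 fun z hz h => hA ?_
      rw [← h]
      exact (Finset.mem_filter.1 hz).2

end Counting

/-! ### Assembly of the covariance bound. -/

section Covariance

variable {H d : ℕ}

theorem memLp_sum_monom {n : ℕ} {ι : Type*} (Z : Finset ι) (b : ι → ℝ)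
    (s : ι → Param H d n →₀ ℕ) :
    MemLp (fun θ => ∑ z ∈ Z, b z * monom (s z) θ) 2 (initLaw H d n) :=
  memLp_finsetSum _ fun z _ => (memLp_monom (s z)).const_mul (b z)

theorem covariance_sum_monom {n : ℕ} {ι κ : Type*} (Z : Finset ι) (b : ι → ℝ)
    (s : ι → Param H d n →₀ ℕ) (Y : Finset κ) (a : κ → ℝ) (t : κ → Param H d n →₀ ℕ) :
    cov[fun θ => ∑ z ∈ Z, b z * monom (s z) θ, fun θ => ∑ y ∈ Y, a y * monom (t y) θ;
      initLaw H d n] =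
      ∑ z ∈ Z ×ˢ Y, b z.1 * (a z.2 * cov[monom (s z.1), monom (t z.2); initLaw H d n]) := by
  rw [covariance_fun_sum_fun_sum' (fun z _ => (memLp_monom (s z)).const_mul (b z))
    (fun y _ => (memLp_monom (t y)).const_mul (a y)), Finset.sum_product]
  refine Finset.sum_congr rfl fun z _ => Finset.sum_congr rfl fun y _ => ?_
  rw [covariance_const_mul_left, covariance_const_mul_right]

theorem degree_sum_fullMonom_le_of_admissible (S : TensorProductShape) {n D : ℕ}
    {z : Config S H d n}
    (hz : S.Admissible D z) : (∑ K, S.fullMonom z K).degree ≤ S.m * D := by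
  rw [map_sum]
  exact (Finset.sum_le_sum fun K _ => (hz K).1).trans (by simp)

theorem degree_sum_snd_le_of_admissible (S : TensorProductShape) {n D : ℕ} {z : Config S H d n}
    (hz : S.Admissible D z) : (∑ K, z.2 K).degree ≤ S.m * D := by
  refine le_trans ?_ (S.degree_sum_fullMonom_le_of_admissible hz)
  rw [sum_fullMonom, map_add]
  exact Nat.le_add_right _ _

/-- Converts the exponent inequality of `exponent_bound` into sizes; monotonicity in the exponent
uses `n ≥ 1`. -/
theorem inv_sqrt_pow_le {n w k : ℕ} (hn : 0 < n) {s : ℝ} (h : 2 * (k : ℝ) ≤ w + 2 * s) :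
    (√(n : ℝ))⁻¹ ^ w ≤ (n : ℝ) ^ s * (n : ℝ)⁻¹ ^ k := by
  have hn0 : (0 : ℝ) < n := Nat.cast_pos.2 hn
  have h1 : (√(n : ℝ))⁻¹ ^ w = (n : ℝ) ^ (-(w / 2) : ℝ) := by
    rw [Real.sqrt_eq_rpow, ← Real.rpow_neg hn0.le, ← Real.rpow_mul_natCast hn0.le]
    congr 1
    ring
  have h2 : (n : ℝ)⁻¹ ^ k = (n : ℝ) ^ (-(k : ℝ)) := by
    rw [Real.rpow_neg hn0.le, Real.rpow_natCast, inv_pow]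
  rw [h1, h2, ← Real.rpow_add hn0]
  exact Real.rpow_le_rpow_of_exponent_le (Nat.one_le_cast.2 hn) (by linarith)

theorem memLp_eval (S : TensorProductShape) (φ : Fin (H + 1) → ℝ[X]) (x : Fin S.m → Fin d → ℝ)
    (n : ℕ) : MemLp (S.eval φ x n) 2 (initLaw H d n) := by
  obtain ⟨C, D, -, h⟩ := S.exists_expansion φ x
  obtain ⟨b, hb, -⟩ := h n
  rw [hb]
  exact memLp_sum_monom _ _ _

variable (φ : Fin (H + 1) → ℝ[X]) (S T : TensorProductShape) (x : Fin S.m → Fin d → ℝ)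
  (y : Fin T.m → Fin d → ℝ)

theorem covariance_eval_eq_zero (hodd : Odd (S.nOdd + T.nOdd)) (n : ℕ) :
    cov[S.eval φ x n, T.eval φ y n; initLaw H d n] = 0 := by
  obtain ⟨C, D, -, h⟩ := S.exists_expansion φ x
  obtain ⟨C', D', -, h'⟩ := T.exists_expansion φ y
  obtain ⟨b, hb, hbA, -⟩ := h n
  obtain ⟨a, ha, haA, -⟩ := h' n
  rw [hb, ha, covariance_sum_monom]
  refine Finset.sum_eq_zero fun z _ => ?_
  by_contra h0
  have h1 := right_ne_zero_of_mul (right_ne_zero_of_mul h0)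
  exact Nat.not_even_iff_odd.2 hodd (exponent_bound S T (hbA _ (left_ne_zero_of_mul h0))
    (haA _ (left_ne_zero_of_mul (right_ne_zero_of_mul h0)))
    (even_of_covariance_monom_ne_zero h1) (exists_common_of_covariance_monom_ne_zero h1)).1

theorem covariance_eval_isBigO :
    (fun n : ℕ => cov[S.eval φ x n, T.eval φ y n; initLaw H d n])
      =O[atTop] fun n : ℕ => (n : ℝ) ^ sV S T := by
  obtain ⟨C, D, hC, h⟩ := S.exists_expansion φ x
  obtain ⟨C', D', hC', h'⟩ := T.exists_expansion φ y
  obtain ⟨M, hM, hcov⟩ := exists_abs_covariance_monom_le (H := H) (d := d) (S.m * D + T.m * D')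
  obtain ⟨N, hN⟩ := exists_sum_inv_pow_card_neurons_le S T H d D D' (2 * (S.m * D + T.m * D'))
  refine IsBigO.of_bound (C * C' * M * N) ?_
  filter_upwards [eventually_gt_atTop 0] with n hn
  obtain ⟨b, hb, hbA, hbC⟩ := h n
  obtain ⟨a, ha, haA, haC⟩ := h' n
  rw [hb, ha, covariance_sum_monom, Real.norm_eq_abs, Real.norm_of_nonneg (by positivity)]
  set c : Config S H d n × Config T H d n → ℝ := fun z =>
    cov[monom (∑ K, z.1.2 K), monom (∑ K, z.2.2 K); initLaw H d n] with hc
  have hterm : ∀ z, b z.1 * (a z.2 * c z) ≠ 0 →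
      (neurons (pairMonom S T z)).card ≤ 2 * (S.m * D + T.m * D') ∧
      |b z.1 * (a z.2 * c z)| ≤ C * C' * M * (n : ℝ) ^ sV S T *
        (n : ℝ)⁻¹ ^ (neurons (pairMonom S T z)).card := by
    intro z h0
    have hz := hbA _ (left_ne_zero_of_mul h0)
    have hz' := haA _ (left_ne_zero_of_mul (right_ne_zero_of_mul h0))
    have h1 := right_ne_zero_of_mul (right_ne_zero_of_mul h0)
    have hexp := (exponent_bound S T hz hz' (even_of_covariance_monom_ne_zero h1)
      (exists_common_of_covariance_monom_ne_zero h1)).2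
    constructor
    · refine (card_neurons_le _).trans (Nat.mul_le_mul_left 2 ?_)
      rw [pairMonom, map_add]
      exact add_le_add (S.degree_sum_fullMonom_le_of_admissible hz)
        (T.degree_sum_fullMonom_le_of_admissible hz')
    · have hcz : |c z| ≤ M := hcov n _ _
        ((S.degree_sum_snd_le_of_admissible hz).trans (Nat.le_add_right _ _))
        ((T.degree_sum_snd_le_of_admissible hz').trans (Nat.le_add_left _ _))
      have hw : (√(n : ℝ))⁻¹ ^ degWV (∑ K, S.fullMonom z.1 K) *
          (√(n : ℝ))⁻¹ ^ degWV (∑ K, T.fullMonom z.2 K) ≤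
          (n : ℝ) ^ sV S T * (n : ℝ)⁻¹ ^ (neurons (pairMonom S T z)).card := by
        rw [← pow_add, ← map_add]
        exact inv_sqrt_pow_le hn hexp
      rw [abs_mul, abs_mul]
      calc |b z.1| * (|a z.2| * |c z|)
          ≤ (C * (√(n : ℝ))⁻¹ ^ degWV (∑ K, S.fullMonom z.1 K)) *
            ((C' * (√(n : ℝ))⁻¹ ^ degWV (∑ K, T.fullMonom z.2 K)) * M) := by
            gcongr
            exacts [hbC z.1, haC z.2]
        _ = C * C' * M * ((√(n : ℝ))⁻¹ ^ degWV (∑ K, S.fullMonom z.1 K) *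
            (√(n : ℝ))⁻¹ ^ degWV (∑ K, T.fullMonom z.2 K)) := by ring
        _ ≤ C * C' * M * ((n : ℝ) ^ sV S T *
            (n : ℝ)⁻¹ ^ (neurons (pairMonom S T z)).card) := by gcongr
        _ = _ := by ring
  calc |∑ z ∈ S.boxConfigs H d n D ×ˢ T.boxConfigs H d n D', b z.1 * (a z.2 * c z)|
      ≤ ∑ z ∈ S.boxConfigs H d n D ×ˢ T.boxConfigs H d n D', |b z.1 * (a z.2 * c z)| :=
        Finset.abs_sum_le_sum_abs _ _
    -- The boxes contain monomials of degree growing with `n`; those configurations have zero terms,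
    -- and the remaining ones meet a bounded number of neurons.
    _ = ∑ z ∈ S.boxConfigs H d n D ×ˢ T.boxConfigs H d n D' with
          (neurons (pairMonom S T z)).card ≤ 2 * (S.m * D + T.m * D'),
          |b z.1 * (a z.2 * c z)| := by
        refine (Finset.sum_filter_of_ne fun z _ h0 => ?_).symm
        exact (hterm z (abs_ne_zero.1 h0)).1
    _ ≤ ∑ z ∈ S.boxConfigs H d n D ×ˢ T.boxConfigs H d n D' with
          (neurons (pairMonom S T z)).card ≤ 2 * (S.m * D + T.m * D'),
          C * C' * M * (n : ℝ) ^ sV S T * (n : ℝ)⁻¹ ^ (neurons (pairMonom S T z)).card := by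
        refine Finset.sum_le_sum fun z _ => ?_
        by_cases h0 : b z.1 * (a z.2 * c z) = 0
        · rw [h0, abs_zero]; positivity
        · exact (hterm z h0).2
    _ ≤ C * C' * M * (n : ℝ) ^ sV S T * N := by
        rw [← Finset.mul_sum]
        exact mul_le_mul_of_nonneg_left (hN n hn) (by positivity)
    _ = C * C' * M * N * (n : ℝ) ^ sV S T := by ring

end Covariance

end TensorProductShape

end WideNet

end

theorem mainTheorem2 {H d : ℕ} (φ : Fin (H + 1) → ℝ[X]) (S T : WideNet.TensorProductShape)
    (x : Fin S.m → Fin d → ℝ) (y : Fin T.m → Fin d → ℝ) :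
    (∀ n : ℕ, MemLp (S.eval φ x n) 2 (WideNet.initLaw H d n) ∧
      MemLp (T.eval φ y n) 2 (WideNet.initLaw H d n)) ∧
    (Even (S.nOdd + T.nOdd) →
      (fun n : ℕ => cov[S.eval φ x n, T.eval φ y n; WideNet.initLaw H d n])
        =O[atTop] fun n : ℕ => (n : ℝ) ^ WideNet.sV S T) ∧
    (Odd (S.nOdd + T.nOdd) →
      ∀ n : ℕ, cov[S.eval φ x n, T.eval φ y n; WideNet.initLaw H d n] = 0) :=
  ⟨fun n => ⟨S.memLp_eval φ x n, T.memLp_eval φ y n⟩,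
    fun _ => WideNet.TensorProductShape.covariance_eval_isBigO φ S T x y,
    fun h n => WideNet.TensorProductShape.covariance_eval_eq_zero φ S T x y h n⟩
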